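/- Let $\mathbb D=\{z\in\mathbb C:|z|<1\}$ and $\overline{\mathbb C}=\mathbb C\cup\{\infty\}$. For $p\in(0,1)$ let $Co(p)$ be the class of functions $f:\mathbb D\to\overline{\mathbb C}$ such that (i) $f$ is meromorphic in $\mathbb D$ and has a simple pole at the point $p$; (ii) $f(0)=0$ and $f'(0)=1$; (iii) $f$ maps $\mathbb D$ conformally (that is, injectively) onto a set whose complement with respect to $\overline{\mathbb C}$ is convex. Each $f\in Co(p)$ has a unique Laurent expansion $$f(z)=\sum_{n=-1}^{\infty}a_n(f)(z-p)^n,\qquad 0<|z-p|<1-p.$$ For $c\in\mathbb C$ with $|c|\le 1$ put $$f_c(z)=\frac{z-\frac{p}{1+p^2}(1+c)z^2}{\left(1-\frac zp\right)(1-zp)},\qquad z\in\mathbb D,$$ with $f_c(p)=\infty$. Theorem. Let $p\in(0,\sqrt3-1]$. Then the set of values $\{a_0(f): f\in Co(p)\}$ is exactly the closed disc of all $w\in\mathbb C$ with $$\left|\frac{1-p^2}{p}\,w+\frac{1-p^2+p^4}{1-p^4}\right|\le\frac{p^2(2-p^2)}{1-p^4}.$$ For $f\in Co(p)$, equality holds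 in this inequality with $w=a_0(f)$ if and only if $f=f_{e^{i\theta}}$ for some $\theta\in[0,2\pi]$. Moreover, $f_c\in Co(p)$ for every $c$ with $|c|\le1$, and every point $w$ of the disc equals $a_0(f_c)$ for some such $c$. -/

import Mathlib

open scoped Complex.UnitDisc OnePoint

noncomputable section

namespace Concave

/-- The finite part of a map from the unit disc to the Riemann sphere `OnePoint ℂ`, as a function
on `ℂ`: the value `∞` is replaced by `0`, and the function is `0` off the disc. Only its values at
points of the disc where the map is finite carry information. -/
def finitePart (f : 𝔻 → OnePoint ℂ) (z : ℂ) : ℂ :=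
  if h : ‖z‖ < 1 then (f (Complex.UnitDisc.mk z h)).elim 0 id else 0

/-- `f : 𝔻 → OnePoint ℂ` is meromorphic: it is holomorphic near every point where it is finite,
and it has a pole at every point where it takes the value `∞`. -/
def IsMeromorphic (f : 𝔻 → OnePoint ℂ) : Prop :=
  ∀ z : 𝔻,
    (f z ≠ ∞ → AnalyticAt ℂ (finitePart f) z) ∧
    (f z = ∞ → MeromorphicAt (finitePart f) z ∧ meromorphicOrderAt (finitePart f) z < 0)

/-- The class `Co(p)` of concave univalent functions with pole at `p ∈ (0, 1)`. -/
structure IsConcave (p : ℝ) (f : 𝔻 → OnePoint ℂ) : Prop where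
  meromorphic : IsMeromorphic f
  /-- `f` has a simple pole at `p` -/
  simple_pole : meromorphicOrderAt (finitePart f) (p : ℂ) = -1
  map_zero : f 0 = ((0 : ℂ) : OnePoint ℂ)
  deriv_zero : deriv (finitePart f) 0 = 1
  /-- `f` is a conformal map of the disc onto its image -/
  injective : Function.Injective f
  /-- the complement of the image in the sphere is a convex subset of the plane -/
  convex_compl : ∃ K : Set ℂ, Convex ℝ K ∧
    (Set.range f)ᶜ = (fun w : ℂ => (w : OnePoint ℂ)) '' K

/-- The class `Co(p)` as a set of functions. -/
def Co (p : ℝ) : Set (𝔻 → OnePoint ℂ) := {f | IsConcave p f}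

/-- `f(z) = ∑_{n ≥ -1} a n * (z - p) ^ n` for `0 < |z - p| < 1 - p`. -/
def HasLaurentExpansion (p : ℝ) (f : 𝔻 → OnePoint ℂ) (a : ℤ → ℂ) : Prop :=
  (∀ n : ℤ, n < -1 → a n = 0) ∧
  ∀ z : ℂ, 0 < ‖z - (p : ℂ)‖ → ‖z - (p : ℂ)‖ < 1 - p →
    HasSum (fun n : ℤ => a n * (z - (p : ℂ)) ^ n) (finitePart f z)

open Classical in
/-- The Laurent coefficients `a_n(f)` of `f` at `p` (zero if there is no expansion). -/
def laurentCoeff (p : ℝ) (f : 𝔻 → OnePoint ℂ) : ℤ → ℂ :=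
  if h : ∃ a, HasLaurentExpansion p f a then h.choose else 0

/-- The function
`z ↦ (z - p / (1 + p²) * (1 + ω(z)) * z²) / ((1 - z / p) * (1 - z * p))`
from the disc to the sphere, with its pole at `p`. -/
def rep (p : ℝ) (ω : 𝔻 → ℂ) (z : 𝔻) : OnePoint ℂ :=
  if (z : ℂ) = (p : ℂ) then ∞ else
    (((z : ℂ) - (p : ℂ) / (1 + (p : ℂ) ^ 2) * (1 + ω z) * (z : ℂ) ^ 2) /
      ((1 - (z : ℂ) / (p : ℂ)) * (1 - (z : ℂ) * (p : ℂ))) : ℂ)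

/-- The extremal functions: `rep` with the constant `exp (iθ)`. -/
def extremal (p θ : ℝ) : 𝔻 → OnePoint ℂ :=
  rep p fun _ => Complex.exp (Complex.I * (θ : ℂ))


end Concave

end

/-!
A Möbius map moves the pole to `0`, where `f` becomes `F z = E z / z` with `E` holomorphic. By
convexity of the omitted set `K`, a convex combination of `F (μ * z)` and `F (ν * z)`, with `μ` and
`ν` unimodular, cannot tend to a value of `F` as `‖z‖` tends to `1`. A Schwarz lemma for its
pullback through `F` thus shows that `{F y | r ≤ ‖y‖} ∪ K` is convex for every `r`, which in
infinitesimal form reads `0 ≤ ((F x - F z) / (z * F' z)).re` for `‖x‖ = ‖z‖`. The reciprocal of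
this quotient extends, up to an explicit summand, to a holomorphic function of two variables, so
the maximum principle carries the inequality to the whole bidisc and bounds the associated Schur
function by `1`. Freezing one variable at the zero of `E` gives `f = rep p ω` with `ω` holomorphic
and `‖ω‖ ≤ 1`.

In these terms `a₀ f` is affine in `ω p` and `ω' p`, and the Schwarz-Pick inequality confines it to
the disc as long as `0 ≤ 2 - 2 * p - p ^ 2`, with equality only for unimodular constants.
Conversely, for constant `ω` the function `rep p ω` is a Joukowski map between Möbius and affine
changes of variable, so it omits a full ellipse.
-/

noncomputable section

open Filter Function Metric Set Topology
open scoped ComplexConjugate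

namespace Concave

section Univalent

variable {U : Set ℂ} {g k : ℂ → ℂ} {z : ℂ}

theorem nhds_le_map_of_injOn (hU : IsOpen U) (hg : DifferentiableOn ℂ g U) (hinj : InjOn g U)
    (hz : z ∈ U) : 𝓝 (g z) ≤ map g (𝓝 z) := by
  refine (hg.analyticAt (hU.mem_nhds hz)).eventually_constant_or_nhds_le_map_nhds.resolve_left
    fun hconst => ?_
  have hU' : ∀ᶠ w in 𝓝[≠] z, w ∈ U ∧ g w = g z :=
    ((hU.eventually_mem hz).and hconst).filter_mono nhdsWithin_le_nhds
  obtain ⟨w, ⟨hw, hwz⟩, hne⟩ := (hU'.and self_mem_nhdsWithin).exists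
  exact hne (hinj hw hz hwz)

theorem isOpen_image_of_injOn (hU : IsOpen U) (hg : DifferentiableOn ℂ g U) (hinj : InjOn g U) :
    IsOpen (g '' U) := by
  rw [isOpen_iff_mem_nhds]
  rintro _ ⟨x, hx, rfl⟩
  exact nhds_le_map_of_injOn hU hg hinj hx (image_mem_map (hU.mem_nhds hx))

theorem eventually_deriv_ne_zero_of_injOn (hU : IsOpen U) (hg : DifferentiableOn ℂ g U)
    (hinj : InjOn g U) (hz : z ∈ U) : ∀ᶠ w in 𝓝[≠] z, deriv g w ≠ 0 := by
  have hana := (hg.analyticAt (hU.mem_nhds hz)).deriv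
  refine hana.eventually_eq_zero_or_eventually_ne_zero.resolve_left fun hzero => ?_
  obtain ⟨r, hr, hball⟩ := eventually_nhds_iff_ball.1 ((hU.eventually_mem hz).and hzero)
  have hmem : ∀ᶠ w in 𝓝[≠] z, w ∈ ball z r := nhdsWithin_le_nhds (ball_mem_nhds z hr)
  obtain ⟨w, hw, hne⟩ := (hmem.and self_mem_nhdsWithin).exists
  exact hne (hinj (hball w hw).1 hz (isOpen_ball.is_const_of_deriv_eq_zero
    (convex_ball z r).isPreconnected (hg.mono fun x hx => (hball x hx).1)
    (fun x hx => (hball x hx).2) hw (mem_ball_self hr)))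

theorem continuousAt_of_leftInvOn (hU : IsOpen U) (hg : DifferentiableOn ℂ g U)
    (hk : LeftInvOn k g U) (hz : z ∈ U) : ContinuousAt k (g z) := by
  have hcomp : Tendsto (k ∘ g) (𝓝 z) (𝓝 z) := tendsto_id.congr' <| by
    filter_upwards [hU.eventually_mem hz] with w hw using (hk hw).symm
  rw [ContinuousAt, hk hz]
  exact (tendsto_map'_iff.2 hcomp).mono_left (nhds_le_map_of_injOn hU hg hk.injOn hz)

theorem hasDerivAt_of_leftInvOn (hU : IsOpen U) (hg : DifferentiableOn ℂ g U)
    (hk : LeftInvOn k g U) (hz : z ∈ U) (hd : deriv g z ≠ 0) :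
    HasDerivAt k (deriv g z)⁻¹ (g z) := by
  have hgz : HasDerivAt g (deriv g z) (k (g z)) := by
    rw [hk hz]
    exact (hg.differentiableAt (hU.mem_nhds hz)).hasDerivAt
  refine hgz.of_local_left_inverse (continuousAt_of_leftInvOn hU hg hk hz) hd
    (nhds_le_map_of_injOn hU hg hk.injOn hz ?_)
  rw [mem_map]
  filter_upwards [hU.eventually_mem hz] with w hw using congrArg g (hk hw)

theorem hasDerivAt_add_mul_of_leftInvOn (hU : IsOpen U) (hg : DifferentiableOn ℂ g U)
    (hk : LeftInvOn k g U) (hz : z ∈ U) (hd : deriv g z ≠ 0) (v : ℂ) :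
    HasDerivAt (fun t : ℝ => k (g z + t * v)) ((deriv g z)⁻¹ * v) 0 := by
  have hseg : HasDerivAt (fun t : ℝ => g z + t * v) v 0 := by
    simpa only [Complex.ofRealCLM_apply, Complex.ofReal_one, one_mul] using
      ((Complex.ofRealCLM.hasDerivAt (x := (0 : ℝ))).mul_const v).const_add (g z)
  refine HasDerivAt.comp (h₂ := k) (h := fun t : ℝ => g z + t * v) 0 ?_ hseg
  rw [Complex.ofReal_zero, zero_mul, add_zero]
  exact hasDerivAt_of_leftInvOn hU hg hk hz hd

theorem analyticAt_of_leftInvOn (hU : IsOpen U) (hg : DifferentiableOn ℂ g U)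
    (hk : LeftInvOn k g U) (hz : z ∈ U) : AnalyticAt ℂ k (g z) := by
  refine Complex.analyticAt_of_differentiable_on_punctured_nhds_of_continuousAt ?_
    (continuousAt_of_leftInvOn hU hg hk hz)
  have hd := eventually_nhdsWithin_iff.1 (eventually_deriv_ne_zero_of_injOn hU hg hk.injOn hz)
  refine eventually_nhdsWithin_iff.2 (nhds_le_map_of_injOn hU hg hk.injOn hz (mem_map.2 ?_))
  filter_upwards [hd, hU.eventually_mem hz] with w hw hwU hne
  refine (hasDerivAt_of_leftInvOn hU hg hk hwU (hw fun h => hne ?_)).differentiableAt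
  rw [mem_singleton_iff.1 h, mem_singleton_iff]

theorem deriv_ne_zero_of_injOn (hU : IsOpen U) (hg : DifferentiableOn ℂ g U) (hinj : InjOn g U)
    (hz : z ∈ U) : deriv g z ≠ 0 := fun h0 => by
  have hk := hinj.leftInvOn_invFunOn
  have hcomp : HasDerivAt (invFunOn g U ∘ g) (deriv (invFunOn g U) (g z) * deriv g z) z :=
    (analyticAt_of_leftInvOn hU hg hk hz).differentiableAt.hasDerivAt.comp z
      (hg.differentiableAt (hU.mem_nhds hz)).hasDerivAt
  have hid : HasDerivAt (invFunOn g U ∘ g) 1 z := (hasDerivAt_id z).congr_of_eventuallyEq <| by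
    filter_upwards [hU.eventually_mem hz] with w hw using hk hw
  simpa [h0] using hcomp.unique hid

theorem exists_differentiableOn_lift {f : ℂ → ℂ} {V : Set ℂ} (hU : IsOpen U)
    (hg : DifferentiableOn ℂ g U) (hinj : InjOn g U) (hf : DifferentiableOn ℂ f V) :
    ∃ h : ℂ → ℂ, DifferentiableOn ℂ h (V ∩ f ⁻¹' (g '' U)) ∧
      ∀ x ∈ V ∩ f ⁻¹' (g '' U), h x ∈ U ∧ g (h x) = f x := by
  have hk : LeftInvOn (invFunOn g U) g U := hinj.leftInvOn_invFunOn
  refine ⟨invFunOn g U ∘ f, ?_, ?_⟩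
  · rintro x ⟨hx, z, hz, hzx⟩
    exact DifferentiableAt.comp_differentiableWithinAt x
      (hzx ▸ (analyticAt_of_leftInvOn hU hg hk hz).differentiableAt)
      ((hf x hx).mono inter_subset_left)
  · rintro x ⟨-, z, hz, hzx⟩
    rw [comp_apply, ← hzx, hk hz]
    exact ⟨hz, rfl⟩

end Univalent

section Mobius

variable {a z : ℂ}

/-- The automorphism of the unit disc that takes `a` to `0`, for `‖a‖ < 1`; its inverse is
`mobius (-a)`. -/
def mobius (a z : ℂ) : ℂ := (z - a) / (1 - conj a * z)

@[simp]
theorem mobius_self (a : ℂ) : mobius a a = 0 := by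
  simp only [mobius, sub_self, zero_div]

@[simp]
theorem mobius_zero_right (a : ℂ) : mobius a 0 = -a := by
  simp only [mobius, zero_sub, mul_zero, sub_zero, div_one]

theorem norm_sq_one_sub_conj_mul_sub_norm_sq_sub (a z : ℂ) :
    ‖1 - conj a * z‖ ^ 2 - ‖z - a‖ ^ 2 = (1 - ‖a‖ ^ 2) * (1 - ‖z‖ ^ 2) := by
  simp only [Complex.sq_norm, Complex.normSq_apply, Complex.sub_re, Complex.sub_im, Complex.one_re,
    Complex.one_im, Complex.mul_re, Complex.mul_im, Complex.conj_re, Complex.conj_im]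
  ring

theorem one_sub_conj_mul_ne_zero (ha : ‖a‖ < 1) (hz : ‖z‖ ≤ 1) : 1 - conj a * z ≠ 0 := fun h => by
  have hnorm := congrArg norm (sub_eq_zero.1 h)
  rw [norm_one, norm_mul, RCLike.norm_conj] at hnorm
  nlinarith [norm_nonneg a]

theorem norm_mobius_le_one (ha : ‖a‖ < 1) (hz : ‖z‖ ≤ 1) : ‖mobius a z‖ ≤ 1 := by
  rw [mobius, norm_div, div_le_one (norm_pos_iff.2 (one_sub_conj_mul_ne_zero ha hz)),
    ← sq_le_sq₀ (norm_nonneg _) (norm_nonneg _), ← sub_nonneg,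
    norm_sq_one_sub_conj_mul_sub_norm_sq_sub]
  exact mul_nonneg (sub_nonneg.2 (pow_le_one₀ (norm_nonneg a) ha.le))
    (sub_nonneg.2 (pow_le_one₀ (norm_nonneg z) hz))

theorem norm_mobius_lt_one (ha : ‖a‖ < 1) (hz : ‖z‖ < 1) : ‖mobius a z‖ < 1 := by
  rw [mobius, norm_div, div_lt_one (norm_pos_iff.2 (one_sub_conj_mul_ne_zero ha hz.le)),
    ← sq_lt_sq₀ (norm_nonneg _) (norm_nonneg _), ← sub_pos,
    norm_sq_one_sub_conj_mul_sub_norm_sq_sub]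
  exact mul_pos (sub_pos.2 (pow_lt_one₀ (norm_nonneg a) ha two_ne_zero))
    (sub_pos.2 (pow_lt_one₀ (norm_nonneg z) hz two_ne_zero))

theorem mobius_neg_mobius (ha : ‖a‖ < 1) (hz : ‖z‖ ≤ 1) : mobius (-a) (mobius a z) = z := by
  have hden := one_sub_conj_mul_ne_zero ha hz
  have hden' : (1 - conj a * a : ℂ) ≠ 0 := one_sub_conj_mul_ne_zero ha ha.le
  have hsum : 1 + conj a * mobius a z = (1 - conj a * a) / (1 - conj a * z) := by
    rw [mobius]
    field_simp
    ring
  have hnum : mobius a z + a = (1 - conj a * a) * z / (1 - conj a * z) := by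
    rw [mobius, div_add' _ _ _ hden]
    ring
  rw [mobius, map_neg, sub_neg_eq_add, neg_mul, sub_neg_eq_add, hsum, hnum,
    div_div_div_cancel_right₀ hden, mul_div_cancel_left₀ _ hden']

theorem mobius_mobius_neg (ha : ‖a‖ < 1) (hz : ‖z‖ ≤ 1) : mobius a (mobius (-a) z) = z := by
  simpa only [neg_neg] using mobius_neg_mobius ((norm_neg a).trans_lt ha) hz

theorem mobius_eq_zero_iff (ha : ‖a‖ < 1) (hz : ‖z‖ ≤ 1) : mobius a z = 0 ↔ z = a := by
  rw [mobius, div_eq_zero_iff, or_iff_left (one_sub_conj_mul_ne_zero ha hz), sub_eq_zero]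

theorem hasDerivAt_mobius (ha : ‖a‖ < 1) (hz : ‖z‖ ≤ 1) :
    HasDerivAt (mobius a) ((1 - ‖a‖ ^ 2) / (1 - conj a * z) ^ 2) z := by
  refine (((hasDerivAt_id z).sub_const a).div (((hasDerivAt_id z).const_mul (conj a)).const_sub 1)
    (one_sub_conj_mul_ne_zero ha hz)).congr_deriv ?_
  rw [← Complex.conj_mul', id]
  ring

theorem eq_of_norm_eq_one {Ω : ℂ → ℂ} {x y : ℂ} (hΩ : DifferentiableOn ℂ Ω (ball 0 1))
    (hΩ1 : ∀ x ∈ ball 0 1, ‖Ω x‖ ≤ 1) (hx : ‖x‖ < 1) (hy : ‖y‖ < 1) (hxΩ : ‖Ω x‖ = 1) :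
    Ω y = Ω x :=
  Complex.eqOn_of_isPreconnected_of_isMaxOn_norm (convex_ball 0 1).isPreconnected isOpen_ball hΩ
    (mem_ball_zero_iff.2 hx) (fun w hw => (hΩ1 w hw).trans_eq hxΩ.symm) (mem_ball_zero_iff.2 hy)

theorem norm_deriv_mul_le_one_sub_norm_sq {Ω : ℂ → ℂ} (hΩ : DifferentiableOn ℂ Ω (ball 0 1))
    (hΩ1 : ∀ x ∈ ball 0 1, ‖Ω x‖ ≤ 1) (ha : ‖a‖ < 1) :
    ‖deriv Ω a‖ * (1 - ‖a‖ ^ 2) ≤ 1 - ‖Ω a‖ ^ 2 := by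
  have ha' : ‖-a‖ < 1 := (norm_neg a).trans_lt ha
  obtain hlt | heq := (hΩ1 a (mem_ball_zero_iff.2 ha)).lt_or_eq
  · let g : ℂ → ℂ := mobius (Ω a) ∘ Ω ∘ mobius (-a)
    have hmem : ∀ x ∈ ball (0 : ℂ) 1, mobius (-a) x ∈ ball 0 1 := fun x hx =>
      mem_ball_zero_iff.2 (norm_mobius_lt_one ha' (mem_ball_zero_iff.1 hx))
    have hderiv : ∀ x ∈ ball (0 : ℂ) 1, HasDerivAt g
        ((1 - ‖Ω a‖ ^ 2) / (1 - conj (Ω a) * Ω (mobius (-a) x)) ^ 2 *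
          (deriv Ω (mobius (-a) x) * ((1 - ‖-a‖ ^ 2) / (1 - conj (-a) * x) ^ 2))) x := fun x hx =>
      (hasDerivAt_mobius hlt (hΩ1 _ (hmem x hx))).comp x
        ((hΩ.differentiableAt (isOpen_ball.mem_nhds (hmem x hx))).hasDerivAt.comp x
          (hasDerivAt_mobius ha' (mem_ball_zero_iff.1 hx).le))
    have hg0 : g 0 = 0 := by simp only [g, comp_apply, mobius_zero_right, neg_neg, mobius_self]
    have hmaps : MapsTo g (ball 0 1) (closedBall (g 0) 1) := fun x hx => by
      rw [hg0, mem_closedBall_zero_iff]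
      exact norm_mobius_le_one hlt (hΩ1 _ (hmem x hx))
    have hpos : 0 < 1 - ‖Ω a‖ ^ 2 := sub_pos.2 (pow_lt_one₀ (norm_nonneg _) hlt two_ne_zero)
    have hschwarz := Complex.norm_deriv_le_one_of_mapsTo_ball
      (fun x hx => (hderiv x hx).differentiableAt.differentiableWithinAt) hmaps one_pos
    have hg' : deriv g 0 = deriv Ω a * (1 - ‖a‖ ^ 2 : ℝ) / (1 - ‖Ω a‖ ^ 2 : ℝ) := by
      have hne : (1 - ‖Ω a‖ ^ 2 : ℂ) ≠ 0 := mod_cast hpos.ne'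
      rw [(hderiv 0 (mem_ball_self one_pos)).deriv]
      simp only [mobius_zero_right, neg_neg, norm_neg, mul_zero, sub_zero, Complex.conj_mul']
      push_cast
      field_simp
    rwa [hg', norm_div, norm_mul, Complex.norm_of_nonneg hpos.le, Complex.norm_of_nonneg
      (sub_nonneg.2 (pow_le_one₀ (norm_nonneg a) ha.le)), div_le_one hpos] at hschwarz
  · have hconst : Ω =ᶠ[𝓝 a] fun _ => Ω a := by
      filter_upwards [isOpen_ball.mem_nhds (mem_ball_zero_iff.2 ha)] with x hx
      exact eq_of_norm_eq_one hΩ hΩ1 ha (mem_ball_zero_iff.1 hx) heq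
    simp only [hconst.deriv_eq, deriv_const, norm_zero, zero_mul, heq, one_pow, sub_self, le_refl]

end Mobius

section MaximumPrinciple

theorem norm_le_of_closure_superlevel_subset {N : Set ℂ} {q : ℂ → ℂ} {c : ℝ} {x : ℂ}
    (hN : IsOpen N) (hNb : Bornology.IsBounded N) (hq : DifferentiableOn ℂ q N)
    (hcl : closure {x ∈ N | c < ‖q x‖} ⊆ N) (hx : x ∈ N) : ‖q x‖ ≤ c := by
  by_contra! hcx
  have hopen : IsOpen {x ∈ N | c < ‖q x‖} :=
    hq.continuousOn.norm.isOpen_inter_preimage hN isOpen_Ioi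
  refine hcx.not_ge (Complex.norm_le_of_forall_mem_frontier_norm_le
    (hNb.subset (sep_subset N _)) (hq.mono hcl).diffContOnCl (fun y hy => ?_)
    (subset_closure ⟨hx, hcx⟩))
  rw [hopen.frontier_eq] at hy
  exact not_lt.1 fun hcy => hy.2 ⟨hcl hy.1, hcy⟩

theorem re_nonneg_of_forall_mem_frontier {U : Set ℂ} {Q : ℂ → ℂ} {x : ℂ}
    (hU : Bornology.IsBounded U) (hQ : DiffContOnCl ℂ Q U) (h : ∀ x ∈ frontier U, 0 ≤ (Q x).re)
    (hx : x ∈ closure U) : 0 ≤ (Q x).re := by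
  have hnorm : ∀ y, ‖Complex.exp (-Q y)‖ ≤ 1 ↔ 0 ≤ (Q y).re := fun y => by
    rw [Complex.norm_exp, Real.exp_le_one_iff, Complex.neg_re, neg_nonpos]
  exact (hnorm x).1 (Complex.norm_le_of_forall_mem_frontier_norm_le hU
    (Complex.differentiable_exp.comp_diffContOnCl hQ.neg) (fun y hy => (hnorm y).2 (h y hy)) hx)

theorem accPt_sphere {x₀ : ℂ} (hx₀ : x₀ ≠ 0) : AccPt x₀ (𝓟 (sphere 0 ‖x₀‖)) := by
  have hself : ∀ {x : ℂ}, ‖x‖ = ‖x₀‖ → x ∈ sphere 0 ‖x₀‖ := mem_sphere_zero_iff_norm.2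
  refine IsPreconnected.preperfect_of_nontrivial
    ⟨x₀, hself rfl, -x₀, hself (norm_neg x₀), self_ne_neg.2 hx₀⟩
    (isPreconnected_sphere ?_ 0 ‖x₀‖) x₀ (hself rfl)
  simp only [Complex.rank_real_complex, Nat.one_lt_ofNat]

theorem re_nonneg_of_forall_mem_sphere_ne {Q : ℂ → ℂ} {x₀ : ℂ} (hx₀ : x₀ ≠ 0)
    (hQ : ContinuousAt Q x₀) (h : ∀ x, ‖x‖ = ‖x₀‖ → x ≠ x₀ → 0 ≤ (Q x).re) :
    0 ≤ (Q x₀).re := by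
  have : NeBot (𝓝[≠] x₀ ⊓ 𝓟 (sphere 0 ‖x₀‖)) := accPt_sphere hx₀
  have hlim : Tendsto (fun x => (Q x).re) (𝓝[≠] x₀ ⊓ 𝓟 (sphere 0 ‖x₀‖)) (𝓝 (Q x₀).re) :=
    (Complex.continuous_re.continuousAt.comp hQ).tendsto.mono_left
      (inf_le_left.trans nhdsWithin_le_nhds)
  refine ge_of_tendsto hlim ?_
  filter_upwards [mem_inf_of_left self_mem_nhdsWithin, mem_inf_of_right (mem_principal_self _)]
    with x hne hx using h x (mem_sphere_zero_iff_norm.1 hx) hne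

theorem one_add_ne_zero_of_re_nonneg {a : ℂ} (ha : 0 ≤ (1 + 2 * a).re) : 1 + a ≠ 0 := by
  intro h
  rw [eq_neg_of_add_eq_zero_right h] at ha
  norm_num at ha

theorem norm_div_one_add_le_one {a : ℂ} (ha : 0 ≤ (1 + 2 * a).re) : ‖a / (1 + a)‖ ≤ 1 := by
  have hsq : ‖1 + a‖ ^ 2 = ‖a‖ ^ 2 + (1 + 2 * a).re := by
    simp only [Complex.sq_norm, Complex.normSq_apply, Complex.add_re, Complex.add_im,
      Complex.one_re, Complex.one_im, Complex.mul_re, Complex.re_ofNat, Complex.im_ofNat]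
    ring
  rw [norm_div]
  refine div_le_one_of_le₀ ?_ (norm_nonneg _)
  rw [← sq_le_sq₀ (norm_nonneg _) (norm_nonneg _), hsq]
  exact le_add_of_nonneg_right ha

variable {W : ℂ → ℂ} {R r : ℝ} {x : ℂ}

theorem re_one_add_two_mul_nonneg (hW : DifferentiableOn ℂ W (ball 0 R)) (hr : r ≠ 0) (hrR : r < R)
    (h : ∀ x, ‖x‖ = r → 0 ≤ (1 + 2 * (x * W x)).re) (hx : ‖x‖ ≤ r) :
    0 ≤ (1 + 2 * (x * W x)).re := by
  have hsub : closure (ball (0 : ℂ) r) ⊆ ball 0 R :=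
    closure_ball_subset_closedBall.trans (closedBall_subset_ball hrR)
  refine re_nonneg_of_forall_mem_frontier (U := ball 0 r) (Q := fun x => 1 + 2 * (x * W x))
    isBounded_ball (((differentiableOn_id.mul hW).const_mul 2).const_add 1 |>.mono
      hsub).diffContOnCl (fun y hy => ?_) ?_
  · rw [frontier_ball _ hr, mem_sphere_zero_iff_norm] at hy
    exact h y hy
  · rwa [closure_ball _ hr, mem_closedBall_zero_iff]

theorem norm_div_one_add_mul_le (hW : DifferentiableOn ℂ W (ball 0 R)) (hr : 0 < r) (hrR : r < R)
    (h : ∀ x, ‖x‖ = r → 0 ≤ (1 + 2 * (x * W x)).re) (hx : ‖x‖ ≤ r) :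
    ‖W x / (1 + x * W x)‖ ≤ 1 / r := by
  have hsub : closure (ball (0 : ℂ) r) ⊆ ball 0 R :=
    closure_ball_subset_closedBall.trans (closedBall_subset_ball hrR)
  refine Complex.norm_le_of_forall_mem_frontier_norm_le (U := ball 0 r)
    (f := fun x => W x / (1 + x * W x)) isBounded_ball
    (DifferentiableOn.diffContOnCl ?_) (fun y hy => ?_) ?_
  · refine (hW.mono hsub).div ((differentiableOn_id.mul (hW.mono hsub)).const_add 1) fun y hy => ?_
    rw [closure_ball _ hr.ne', mem_closedBall_zero_iff] at hy
    exact one_add_ne_zero_of_re_nonneg (re_one_add_two_mul_nonneg hW hr.ne' hrR h hy)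
  · rw [frontier_ball _ hr.ne', mem_sphere_zero_iff_norm] at hy
    have hle := norm_div_one_add_le_one (h y hy)
    rwa [mul_div_assoc, norm_mul, hy, mul_comm, ← le_div_iff₀ hr] at hle
  · rwa [closure_ball _ hr.ne', mem_closedBall_zero_iff]

end MaximumPrinciple

/-- The unit disc without its centre. -/
def puncturedDisc : Set ℂ := ball 0 1 \ {0}

theorem mem_puncturedDisc {z : ℂ} : z ∈ puncturedDisc ↔ ‖z‖ < 1 ∧ z ≠ 0 := by
  rw [puncturedDisc, Set.mem_sdiff, mem_ball_zero_iff, mem_singleton_iff]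

theorem isOpen_puncturedDisc : IsOpen puncturedDisc :=
  isOpen_ball.sdiff isClosed_singleton

theorem mul_mem_puncturedDisc {κ z : ℂ} (hκ : ‖κ‖ = 1) (hz : z ∈ puncturedDisc) :
    κ * z ∈ puncturedDisc := by
  rw [mem_puncturedDisc] at hz ⊢
  exact ⟨by rw [norm_mul, hκ, one_mul]; exact hz.1,
    mul_ne_zero (ne_zero_of_norm_ne_zero (hκ.trans_ne one_ne_zero)) hz.2⟩

/-- The function `E z / z`, which for `E` holomorphic with `E 0 ≠ 0` has a simple pole at `0`. -/
def withPole (E : ℂ → ℂ) (z : ℂ) : ℂ := E z / z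

/-- The concave univalent functions of the disc with their pole moved to `0`: `E z / z` is
injective on the punctured disc and the set of values it omits is convex. The pole is cleared so
that the function is described by the holomorphic function `E`. -/
structure ConcaveAtZero (E : ℂ → ℂ) : Prop where
  diff : DifferentiableOn ℂ E (ball 0 1)
  ne_zero : E 0 ≠ 0
  injOn : InjOn (withPole E) puncturedDisc
  convex : Convex ℝ (withPole E '' puncturedDisc)ᶜ

namespace ConcaveAtZero

variable {E : ℂ → ℂ} (hE : ConcaveAtZero E)

include hE

theorem differentiableAt {z : ℂ} (hz : ‖z‖ < 1) : DifferentiableAt ℂ E z :=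
  hE.diff.differentiableAt (isOpen_ball.mem_nhds (mem_ball_zero_iff.2 hz))

theorem differentiableOn_withPole : DifferentiableOn ℂ (withPole E) puncturedDisc :=
  (hE.diff.mono sdiff_subset).div differentiableOn_id fun _ hz => hz.2

theorem isOpen_image : IsOpen (withPole E '' puncturedDisc) :=
  isOpen_image_of_injOn isOpen_puncturedDisc hE.differentiableOn_withPole hE.injOn

/-- All large values are taken close to the pole, hence not elsewhere. -/
theorem exists_norm_withPole_le {r : ℝ} (hr : 0 < r) :
    ∃ B : ℝ, ∀ z, r ≤ ‖z‖ → ‖z‖ < 1 → ‖withPole E z‖ ≤ B := by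
  have hstrict : HasStrictDerivAt (fun z => z / E z) (1 / E 0) 0 := by
    refine ((hasStrictDerivAt_id 0).div (hE.diff.analyticAt
      (ball_mem_nhds 0 one_pos)).hasStrictDerivAt hE.ne_zero).congr_deriv ?_
    rw [zero_mul, one_mul, sub_zero, sq, div_mul_cancel_left₀ hE.ne_zero, one_div]
  have himg : (fun z => z / E z) '' ball 0 r ∈ 𝓝 0 := by
    simpa only [hstrict.map_nhds_eq (one_div_ne_zero hE.ne_zero), zero_div] using
      image_mem_map (m := fun z => z / E z) (ball_mem_nhds (0 : ℂ) hr)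
  obtain ⟨δ, hδ, hball⟩ := Metric.mem_nhds_iff.1 himg
  refine ⟨δ⁻¹, fun z hrz hz1 => ?_⟩
  by_contra! hlt
  have hpos : 0 < ‖withPole E z‖ := (inv_pos.2 hδ).trans hlt
  have hmem : (withPole E z)⁻¹ ∈ ball 0 δ := by
    rw [mem_ball_zero_iff, norm_inv]
    exact inv_lt_of_inv_lt₀ hδ hlt
  obtain ⟨w, hwr, hwz⟩ := hball hmem
  rw [mem_ball_zero_iff] at hwr
  have hwz : withPole E w = withPole E z := by
    rw [withPole, ← inv_div, show w / E w = (withPole E z)⁻¹ from hwz, inv_inv]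
  have hw0 : w ≠ 0 := by
    rintro rfl
    rw [← hwz, withPole, div_zero, norm_zero] at hpos
    exact hpos.false
  have hz0 : z ≠ 0 := norm_pos_iff.1 (hr.trans_le hrz)
  have heq := hE.injOn (mem_puncturedDisc.2 ⟨(hwr.trans_le hrz).trans hz1, hw0⟩)
    (mem_puncturedDisc.2 ⟨hz1, hz0⟩) hwz
  exact (hwr.trans_le hrz).ne (congrArg norm heq)

theorem notMem_image_of_tendsto {ι : Type*} {l : Filter ι} [l.NeBot] {x : ι → ℂ} {a : ℂ}
    (hx : ∀ᶠ i in l, x i ∈ puncturedDisc) (hx1 : Tendsto (fun i => ‖x i‖) l (𝓝 1))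
    (ha : Tendsto (fun i => withPole E (x i)) l (𝓝 a)) : a ∉ withPole E '' puncturedDisc := by
  rintro ⟨y, hy, rfl⟩
  obtain ⟨r, hyr, hr1⟩ := exists_between (mem_puncturedDisc.1 hy).1
  have hV : puncturedDisc ∩ ball 0 r ∈ 𝓝 y := inter_mem (isOpen_puncturedDisc.mem_nhds hy)
    (isOpen_ball.mem_nhds (mem_ball_zero_iff.2 hyr))
  have himg : ∀ᶠ i in l, withPole E (x i) ∈ withPole E '' (puncturedDisc ∩ ball 0 r) :=
    ha (nhds_le_map_of_injOn isOpen_puncturedDisc hE.differentiableOn_withPole hE.injOn hy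
      (image_mem_map hV))
  obtain ⟨i, ⟨⟨w, ⟨hw, hwr⟩, hwx⟩, hri⟩, hxi⟩ :=
    ((himg.and (hx1.eventually (lt_mem_nhds hr1))).and hx).exists
  rw [hE.injOn hw hxi hwx, mem_ball_zero_iff] at hwr
  exact hwr.not_gt hri

theorem exists_tendsto_notMem_image {ι : Type*} {u : Ultrafilter ι} {x : ι → ℂ}
    (hx : ∀ᶠ i in u, x i ∈ puncturedDisc) (hx1 : Tendsto (fun i => ‖x i‖) u (𝓝 1)) :
    ∃ a ∉ withPole E '' puncturedDisc, Tendsto (fun i => withPole E (x i)) u (𝓝 a) := by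
  obtain ⟨B, hB⟩ := hE.exists_norm_withPole_le one_half_pos
  have hmem : closedBall (0 : ℂ) B ∈ u.map fun i => withPole E (x i) := by
    rw [Ultrafilter.mem_map]
    filter_upwards [hx, hx1.eventually (lt_mem_nhds one_half_lt_one)] with i hi hhalf
    exact mem_closedBall_zero_iff.2 (hB _ hhalf.le (mem_puncturedDisc.1 hi).1)
  obtain ⟨a, -, ha⟩ := (isCompact_closedBall (0 : ℂ) B).ultrafilter_le_nhds' _ hmem
  exact ⟨a, hE.notMem_image_of_tendsto hx hx1 ha, ha⟩

theorem mem_and_eq_of_tendsto {ι : Type*} {l : Filter ι} [l.NeBot] {y : ι → ℂ} {w m : ℂ}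
    (hy : ∀ᶠ i in l, y i ∈ puncturedDisc) (hw : ‖w‖ < 1) (hyw : Tendsto y l (𝓝 w))
    (hm : Tendsto (fun i => withPole E (y i)) l (𝓝 m)) :
    w ∈ puncturedDisc ∧ withPole E w = m := by
  have hEw : E w = w * m := by
    refine tendsto_nhds_unique ((hE.differentiableAt hw).continuousAt.tendsto.comp hyw)
      ((hyw.mul hm).congr' ?_)
    filter_upwards [hy] with i hi using mul_div_cancel₀ _ (mem_puncturedDisc.1 hi).2
  have hw0 : w ≠ 0 := by
    rintro rfl
    exact hE.ne_zero (hEw.trans (zero_mul m))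
  exact ⟨mem_puncturedDisc.2 ⟨hw, hw0⟩, by rw [withPole, hEw, mul_div_cancel_left₀ _ hw0]⟩

theorem exists_norm_lt_mul_norm {c : ℝ} (hc : 1 < c) :
    ∃ ε > 0, ∀ z w : ℂ, ‖z‖ < ε → ‖w‖ < ε → ‖E z‖ < c * ‖E w‖ := by
  have hcont : ContinuousAt E 0 := (hE.differentiableAt (by simp)).continuousAt
  obtain ⟨m, hm, hmc⟩ := exists_between (lt_mul_of_one_lt_left (norm_pos_iff.2 hE.ne_zero) hc)
  obtain ⟨ε, hε, hball⟩ := eventually_nhds_iff_ball.1 ((hcont.norm.eventually (gt_mem_nhds hm)).and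
    ((hcont.norm.const_mul c).eventually (lt_mem_nhds hmc)))
  exact ⟨ε, hε, fun z w hz hw =>
    (hball z (mem_ball_zero_iff.2 hz)).1.trans (hball w (mem_ball_zero_iff.2 hw)).2⟩

end ConcaveAtZero

/-- The weighted mean, with weights `s` and `t`, of the values of `E z / z` at two rotations `μ * z`
and `ν * z` of the argument. -/
def rotationMean (E : ℂ → ℂ) (s t : ℝ) (μ ν z : ℂ) : ℂ :=
  s * withPole E (μ * z) + t * withPole E (ν * z)

theorem norm_rotationMean_le {E : ℂ → ℂ} {s t C : ℝ} {μ ν z : ℂ} (hs : 0 ≤ s) (ht : 0 ≤ t)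
    (hst : s + t = 1) (hμ : ‖μ‖ = 1) (hν : ‖ν‖ = 1) (hCμ : ‖E (μ * z)‖ ≤ C)
    (hCν : ‖E (ν * z)‖ ≤ C) : ‖rotationMean E s t μ ν z‖ ≤ C / ‖z‖ :=
  calc ‖rotationMean E s t μ ν z‖
      ≤ s * (‖E (μ * z)‖ / ‖z‖) + t * (‖E (ν * z)‖ / ‖z‖) := by
        refine (norm_add_le _ _).trans_eq ?_
        simp only [withPole, norm_mul, norm_div, hμ, hν, one_mul, Complex.norm_of_nonneg hs,
          Complex.norm_of_nonneg ht]
    _ ≤ s * (C / ‖z‖) + t * (C / ‖z‖) := by gcongr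
    _ = C / ‖z‖ := by rw [← add_mul, hst, one_mul]

namespace ConcaveAtZero

variable {E : ℂ → ℂ} (hE : ConcaveAtZero E) {s t : ℝ} {μ ν : ℂ}

include hE

theorem differentiableOn_rotationMean (hμ : ‖μ‖ = 1) (hν : ‖ν‖ = 1) :
    DifferentiableOn ℂ (rotationMean E s t μ ν) puncturedDisc := by
  have hrot : ∀ {κ : ℂ}, ‖κ‖ = 1 →
      DifferentiableOn ℂ (fun z => withPole E (κ * z)) puncturedDisc := fun hκ =>
    hE.differentiableOn_withPole.comp (differentiableOn_id.const_mul _)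
      fun _ hz => mul_mem_puncturedDisc hκ hz
  exact ((hrot hμ).const_mul _).add ((hrot hν).const_mul _)

variable (hs : 0 ≤ s) (ht : 0 ≤ t) (hst : s + t = 1) (hμ : ‖μ‖ = 1) (hν : ‖ν‖ = 1)

include hs ht hst hμ hν

theorem exists_norm_le_mul_of_rotationMean_eq {c : ℝ} (hc : 1 < c) :
    ∃ ε > 0, ∀ z ∈ puncturedDisc, ∀ y ∈ puncturedDisc, ‖z‖ < ε →
      rotationMean E s t μ ν z = withPole E y → ‖z‖ ≤ c * ‖y‖ := by
  obtain ⟨ε, hε, hnear⟩ := hE.exists_norm_lt_mul_norm hc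
  refine ⟨ε, hε, fun z hz y hy hzε heq => ?_⟩
  by_contra! hlt
  have hy0 := norm_pos_iff.2 (mem_puncturedDisc.1 hy).2
  have hyε : ‖y‖ < ε := (lt_mul_of_one_lt_left hy0 hc).trans (hlt.trans hzε)
  have hrot : ∀ {κ : ℂ}, ‖κ‖ = 1 → ‖E (κ * z)‖ ≤ c * ‖E y‖ := fun hκ =>
    (hnear _ _ (by rwa [norm_mul, hκ, one_mul]) hyε).le
  have hmean := norm_rotationMean_le hs ht hst hμ hν (hrot hμ) (hrot hν)
  rw [heq, withPole, norm_div,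
    div_le_div_iff₀ hy0 (norm_pos_iff.2 (mem_puncturedDisc.1 hz).2)] at hmean
  have hEy : 0 < ‖E y‖ := by nlinarith [hnear y y hyε hyε]
  nlinarith

/-- At a boundary point the mean tends to a convex combination of two omitted values, which is
again omitted. -/
theorem mem_of_tendsto_rotationMean {u : Ultrafilter ℂ} {y : ℂ → ℂ} {z w : ℂ}
    (hu : Tendsto id u (𝓝 z)) (hz0 : z ≠ 0) (hw : ‖w‖ < 1) (hyw : Tendsto y u (𝓝 w))
    (hy : ∀ᶠ v in u, v ∈ puncturedDisc ∧ y v ∈ puncturedDisc ∧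
      withPole E (y v) = rotationMean E s t μ ν v) :
    z ∈ puncturedDisc ∧ rotationMean E s t μ ν z ∈ withPole E '' puncturedDisc := by
  have hmem : ∀ {m : ℂ}, Tendsto (rotationMean E s t μ ν) u (𝓝 m) →
      m ∈ withPole E '' puncturedDisc := fun {m} hm =>
    ⟨w, hE.mem_and_eq_of_tendsto (hy.mono fun v hv => hv.2.1) hw hyw
      (hm.congr' (hy.mono fun v hv => hv.2.2.symm))⟩
  have hz1 : ‖z‖ ≤ 1 := le_of_tendsto hu.norm (hy.mono fun v hv => (mem_puncturedDisc.1 hv.1).1.le)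
  obtain hz1 | hz1 := hz1.lt_or_eq
  · have hz := mem_puncturedDisc.2 ⟨hz1, hz0⟩
    exact ⟨hz, hmem (((hE.differentiableOn_rotationMean hμ hν).differentiableAt
      (isOpen_puncturedDisc.mem_nhds hz)).continuousAt.tendsto.comp hu)⟩
  · have hcluster : ∀ {κ : ℂ}, ‖κ‖ = 1 → ∃ a ∉ withPole E '' puncturedDisc,
        Tendsto (fun v => withPole E (κ * v)) u (𝓝 a) := fun hκ =>
      hE.exists_tendsto_notMem_image (hy.mono fun v hv => mul_mem_puncturedDisc hκ hv.1)
        (by simpa only [norm_mul, hκ, one_mul, hz1, id] using hu.norm)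
    obtain ⟨a, ha, hat⟩ := hcluster hμ
    obtain ⟨b, hb, hbt⟩ := hcluster hν
    have hab : s • a + t • b ∉ withPole E '' puncturedDisc := hE.convex ha hb hs ht hst
    exact absurd (hmem ((hat.const_mul _).add (hbt.const_mul _))) hab

theorem closure_setOf_lt_norm_div_subset {h : ℂ → ℂ} {c : ℝ} (hc : 1 < c)
    (hh : ∀ x ∈ puncturedDisc ∩ rotationMean E s t μ ν ⁻¹' (withPole E '' puncturedDisc),
      h x ∈ puncturedDisc ∧ withPole E (h x) = rotationMean E s t μ ν x) :
    closure {x ∈ puncturedDisc ∩ rotationMean E s t μ ν ⁻¹' (withPole E '' puncturedDisc) |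
        c < ‖x / h x‖} ⊆
      puncturedDisc ∩ rotationMean E s t μ ν ⁻¹' (withPole E '' puncturedDisc) := by
  intro x hx
  have hc0 : 0 < c := one_pos.trans hc
  obtain ⟨ε, hε, hnear⟩ := hE.exists_norm_le_mul_of_rotationMean_eq hs ht hst hμ hν hc
  obtain ⟨u, huU, hux⟩ := mem_closure_iff_ultrafilter.1 hx
  have hU : ∀ᶠ v in u, v ∈ puncturedDisc ∧ (h v ∈ puncturedDisc ∧
      withPole E (h v) = rotationMean E s t μ ν v) ∧ c * ‖h v‖ < ‖v‖ := by
    refine mem_of_superset huU fun v ⟨hv, hlt⟩ => ⟨hv.1, hh v hv, ?_⟩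
    rwa [norm_div, lt_div_iff₀ (norm_pos_iff.2 (mem_puncturedDisc.1 (hh v hv).1).2)] at hlt
  have hid : Tendsto id (u : Filter ℂ) (𝓝 x) := hux
  have hx0 : x ≠ 0 := norm_pos_iff.1 <| hε.trans_le <| ge_of_tendsto hid.norm <| hU.mono
    fun v ⟨hv, ⟨hhv, hval⟩, hlt⟩ => not_lt.1 fun hvε =>
      (hnear v hv _ hhv hvε hval.symm).not_gt hlt
  have hmem : closedBall (0 : ℂ) (1 / c) ∈ u.map h := by
    rw [Ultrafilter.mem_map]
    filter_upwards [hU] with v ⟨hv, _, hlt⟩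
    rw [mem_preimage, mem_closedBall_zero_iff, le_div_iff₀' hc0]
    exact (hlt.trans (mem_puncturedDisc.1 hv).1).le
  obtain ⟨w, hwc, hw⟩ := (isCompact_closedBall (0 : ℂ) (1 / c)).ultrafilter_le_nhds' _ hmem
  exact hE.mem_of_tendsto_rotationMean hs ht hst hμ hν hid hx0
    ((mem_closedBall_zero_iff.1 hwc).trans_lt ((div_lt_one hc0).2 hc)) hw
    (hU.mono fun v hv => ⟨hv.1, hv.2.1⟩)

/-- The Schwarz lemma for `(E z / z)⁻¹ ∘ rotationMean`, which is defined only where the mean is a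
value of `E z / z`. The sets `{E y / y : r ≤ ‖y‖} ∪ K`, with `K` the omitted set, are therefore
convex. -/
theorem norm_le_of_rotationMean_eq {z y : ℂ} (hz : z ∈ puncturedDisc) (hy : y ∈ puncturedDisc)
    (heq : rotationMean E s t μ ν z = withPole E y) : ‖z‖ ≤ ‖y‖ := by
  have hd := hE.differentiableOn_rotationMean (s := s) (t := t) hμ hν
  obtain ⟨h, hhd, hh⟩ := exists_differentiableOn_lift isOpen_puncturedDisc
    hE.differentiableOn_withPole hE.injOn hd
  have hN := hd.continuousOn.isOpen_inter_preimage isOpen_puncturedDisc hE.isOpen_image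
  have hzN : z ∈ puncturedDisc ∩ rotationMean E s t μ ν ⁻¹' (withPole E '' puncturedDisc) :=
    ⟨hz, y, hy, heq.symm⟩
  have hhz : h z = y := hE.injOn (hh z hzN).1 hy ((hh z hzN).2.trans heq)
  rw [← one_mul ‖y‖, ← div_le_iff₀ (norm_pos_iff.2 (mem_puncturedDisc.1 hy).2), ← hhz, ← norm_div]
  refine le_of_forall_gt_imp_ge_of_dense fun c hc => ?_
  exact norm_le_of_closure_superlevel_subset (q := fun x => x / h x) hN
    (isBounded_ball.subset (inter_subset_left.trans sdiff_subset))
    (differentiableOn_id.fun_div hhd fun x hx => (mem_puncturedDisc.1 (hh x hx).1).2)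
    (hE.closure_setOf_lt_norm_div_subset hs ht hst hμ hν hc hh) hzN

end ConcaveAtZero

theorem inner_nonneg_of_eventually_norm_le {V : Type*} [NormedAddCommGroup V]
    [InnerProductSpace ℝ V] {γ : ℝ → V} {γ' : V} {t₀ : ℝ} (hγ : HasDerivAt γ γ' t₀)
    (h : ∀ᶠ t in 𝓝[>] t₀, ‖γ t₀‖ ≤ ‖γ t‖) : 0 ≤ inner ℝ (γ t₀) γ' := by
  have hslope : Tendsto (slope (fun t => ‖γ t‖ ^ 2) t₀) (𝓝[>] t₀) (𝓝 (2 * inner ℝ (γ t₀) γ')) :=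
    (hasDerivAt_iff_tendsto_slope.1 hγ.norm_sq).mono_left (nhdsWithin_mono t₀ fun t ht => ht.ne')
  have hnonneg : 0 ≤ 2 * inner ℝ (γ t₀) γ' := by
    refine ge_of_tendsto hslope ?_
    filter_upwards [h, self_mem_nhdsWithin] with t ht htt
    rw [slope_def_field]
    exact div_nonneg (sub_nonneg.2 (pow_le_pow_left₀ (norm_nonneg _) ht 2)) (sub_pos.2 htt).le
  linarith

theorem dslope_comm {𝕜 : Type*} [NontriviallyNormedField 𝕜] (f : 𝕜 → 𝕜) (a b : 𝕜) :
    dslope f a b = dslope f b a := by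
  obtain rfl | h := eq_or_ne a b
  · rfl
  · rw [dslope_of_ne f h.symm, dslope_of_ne f h, slope_comm]

theorem re_add_div_sub_eq_zero {z x : ℂ} (h : ‖x‖ = ‖z‖) : ((z + x) / (z - x)).re = 0 := by
  have hsq : Complex.normSq x = Complex.normSq z := by
    rw [Complex.normSq_eq_norm_sq, Complex.normSq_eq_norm_sq, h]
  rw [Complex.normSq_apply, Complex.normSq_apply] at hsq
  rw [Complex.div_re, ← add_div, div_eq_zero_iff]
  left
  simp only [Complex.add_re, Complex.sub_re, Complex.add_im, Complex.sub_im]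
  linear_combination -hsq

/-- The holomorphic function on the bidisc which for `x ≠ z` and `F := withPole E` satisfies
`1 + 2 * (z * x * twoPointRatio E z x) = 2 * z * F' z / (F x - F z) + (z + x) / (z - x)`. -/
def twoPointRatio (E : ℂ → ℂ) (z x : ℂ) : ℂ :=
  dslope (dslope E z) z x / (E z - z * dslope E z x)

theorem twoPointRatio_of_ne (E : ℂ → ℂ) {z x : ℂ} (h : x ≠ z) :
    twoPointRatio E z x = (deriv E z - dslope E z x) / (z - x) / (E z - z * dslope E z x) := by
  rw [twoPointRatio, dslope_of_ne (dslope E z) h, slope_def_field, dslope_same,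
    ← neg_sub z x, div_neg, ← neg_div, neg_sub]

/-- The Schur function `T / (1 + z * x * T)` of `T := twoPointRatio E z x`, bounded by `1` because
`0 ≤ (1 + 2 * (z * x * T)).re` on the bidisc. -/
def twoPointSchur (E : ℂ → ℂ) (z x : ℂ) : ℂ :=
  twoPointRatio E z x / (1 + z * x * twoPointRatio E z x)

theorem differentiableOn_dslope_of_norm_lt {E : ℂ → ℂ} {z : ℂ}
    (hE : DifferentiableOn ℂ E (ball 0 1)) (hz : ‖z‖ < 1) :
    DifferentiableOn ℂ (dslope E z) (ball 0 1) :=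
  (Complex.differentiableOn_dslope (isOpen_ball.mem_nhds (mem_ball_zero_iff.2 hz))).2 hE

namespace ConcaveAtZero

variable {E : ℂ → ℂ} (hE : ConcaveAtZero E) {z x : ℂ}

include hE

theorem hasDerivAt_withPole (hz : ‖z‖ < 1) (hz0 : z ≠ 0) :
    HasDerivAt (withPole E) ((deriv E z * z - E z) / z ^ 2) z := by
  refine ((hE.differentiableAt hz).hasDerivAt.div (hasDerivAt_id z) hz0).congr_deriv ?_
  rw [id, mul_one]

theorem deriv_mul_sub_ne_zero (hz : ‖z‖ < 1) : deriv E z * z - E z ≠ 0 := by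
  obtain rfl | hz0 := eq_or_ne z 0
  · rw [mul_zero, zero_sub]
    exact neg_ne_zero.2 hE.ne_zero
  · intro h
    refine deriv_ne_zero_of_injOn isOpen_puncturedDisc hE.differentiableOn_withPole hE.injOn
      (mem_puncturedDisc.2 ⟨hz, hz0⟩) ?_
    rw [(hE.hasDerivAt_withPole hz hz0).deriv, h, zero_div]

theorem sub_mul_dslope_ne_zero (hz : ‖z‖ < 1) (hx : ‖x‖ < 1) : E z - z * dslope E z x ≠ 0 := by
  obtain rfl | hxz := eq_or_ne x z
  · rw [dslope_same, ← neg_ne_zero, neg_sub, mul_comm]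
    exact hE.deriv_mul_sub_ne_zero hx
  rw [dslope_of_ne _ hxz, slope_def_field]
  intro h
  have hcross : x * E z = z * E x := by
    field_simp [sub_ne_zero.2 hxz] at h
    linear_combination h
  obtain rfl | hz0 := eq_or_ne z 0
  · exact mul_ne_zero hxz hE.ne_zero (hcross.trans (zero_mul _))
  obtain rfl | hx0 := eq_or_ne x 0
  · exact mul_ne_zero hxz.symm hE.ne_zero (hcross.symm.trans (zero_mul _))
  refine hxz (hE.injOn (mem_puncturedDisc.2 ⟨hx, hx0⟩) (mem_puncturedDisc.2 ⟨hz, hz0⟩) ?_)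
  rw [withPole, withPole, div_eq_div_iff hx0 hz0]
  linear_combination -hcross

/-- The segment from `F z` to `F x`, where `F := withPole E`, consists of values of rotation means
at `z`, so its preimage under `F` leaves the disc of radius `‖z‖`. -/
theorem re_sub_div_mul_deriv_nonneg (hz : ‖z‖ < 1) (hz0 : z ≠ 0) (hx : ‖x‖ = ‖z‖) :
    0 ≤ ((withPole E x - withPole E z) / (z * deriv (withPole E) z)).re := by
  set F := withPole E
  set v := F x - F z
  have hzD : z ∈ puncturedDisc := mem_puncturedDisc.2 ⟨hz, hz0⟩
  have hF := hE.differentiableOn_withPole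
  have hk := hE.injOn.leftInvOn_invFunOn
  set k := invFunOn F puncturedDisc
  have hγ : HasDerivAt (fun t : ℝ => k (F z + t * v)) ((deriv F z)⁻¹ * v) 0 :=
    hasDerivAt_add_mul_of_leftInvOn isOpen_puncturedDisc hF hk hzD
      (deriv_ne_zero_of_injOn isOpen_puncturedDisc hF hE.injOn hzD) v
  have hseg0 : F z + (0 : ℝ) * v = F z := by rw [Complex.ofReal_zero, zero_mul, add_zero]
  have himg : ∀ᶠ t : ℝ in 𝓝[>] 0, F z + t * v ∈ F '' puncturedDisc := by
    have hseg : Continuous fun t : ℝ => F z + t * v := by fun_prop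
    exact (hseg.tendsto 0 |>.mono_left nhdsWithin_le_nhds).eventually_mem
      (hE.isOpen_image.mem_nhds (by rw [hseg0]; exact mem_image_of_mem F hzD))
  have hnorm : ∀ᶠ t : ℝ in 𝓝[>] 0, ‖z‖ ≤ ‖k (F z + t * v)‖ := by
    filter_upwards [himg, Ioo_mem_nhdsGT one_pos] with t ⟨y, hy, hyt⟩ ⟨ht0, ht1⟩
    rw [← hyt, hk hy]
    refine hE.norm_le_of_rotationMean_eq (sub_nonneg.2 ht1.le) ht0.le (sub_add_cancel 1 t)
      (μ := 1) (ν := x / z) norm_one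
      (by rw [norm_div, hx, div_self (norm_ne_zero_iff.2 hz0)]) hzD hy ?_
    rw [show withPole E y = F z + t * v from hyt, rotationMean, one_mul, div_mul_cancel₀ _ hz0]
    push_cast
    ring
  have hinner : 0 ≤ inner ℝ z ((deriv F z)⁻¹ * v) := by
    have hγ0 : k (F z + (0 : ℝ) * v) = z := by rw [hseg0, hk hzD]
    simpa only [hγ0] using inner_nonneg_of_eventually_norm_le hγ (hγ0.symm ▸ hnorm)
  have hre : (v / (z * deriv F z)).re = inner ℝ z ((deriv F z)⁻¹ * v) / Complex.normSq z := by
    rw [Complex.inner, ← Complex.div_ofReal_re, Complex.normSq_eq_conj_mul_self]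
    field_simp [(map_ne_zero conj).2 hz0]
  rw [hre]
  exact div_nonneg hinner (Complex.normSq_nonneg z)

theorem re_one_add_twoPointRatio_nonneg_of_norm_eq (hz : ‖z‖ < 1) (hx : ‖x‖ = ‖z‖) (hxz : x ≠ z) :
    0 ≤ (1 + 2 * (z * x * twoPointRatio E z x)).re := by
  have hz0 : z ≠ 0 := by
    rintro rfl
    exact hxz (norm_eq_zero.1 (hx.trans norm_zero))
  have hx0 : x ≠ 0 := norm_ne_zero_iff.1 (hx ▸ norm_ne_zero_iff.2 hz0)
  have hsub : x - z ≠ 0 := sub_ne_zero.2 hxz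
  have hden : E z - z * ((E x - E z) / (x - z)) = (x * E z - z * E x) / (x - z) := by
    field_simp
    ring
  have hcross : x * E z - z * E x ≠ 0 := by
    have hne := hE.sub_mul_dslope_ne_zero hz (hx ▸ hz)
    rw [dslope_of_ne _ hxz, slope_def_field, hden] at hne
    exact (div_ne_zero_iff.1 hne).1
  have hinv : 0 ≤ (z * deriv (withPole E) z / (withPole E x - withPole E z)).re := by
    rw [← inv_div, Complex.inv_re]
    exact div_nonneg (hE.re_sub_div_mul_deriv_nonneg hz hz0 hx) (Complex.normSq_nonneg _)
  have hsplit : 1 + 2 * (z * x * twoPointRatio E z x) =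
      2 * (z * deriv (withPole E) z / (withPole E x - withPole E z)) + (z + x) / (z - x) := by
    have hdiff : withPole E x - withPole E z = -(x * E z - z * E x) / (z * x) := by
      rw [withPole, withPole]
      field_simp
      ring
    rw [twoPointRatio_of_ne E hxz, dslope_of_ne _ hxz, slope_def_field, hden,
      (hE.hasDerivAt_withPole hz hz0).deriv, hdiff, ← neg_sub x z]
    field_simp
    ring
  rw [hsplit, Complex.add_re, re_add_div_sub_eq_zero hx, add_zero, two_mul, Complex.add_re]
  exact add_nonneg hinv hinv

theorem differentiableOn_twoPointRatio (hz : ‖z‖ < 1) :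
    DifferentiableOn ℂ (twoPointRatio E z) (ball 0 1) := by
  have hd := differentiableOn_dslope_of_norm_lt hE.diff hz
  exact (differentiableOn_dslope_of_norm_lt hd hz).div ((hd.const_mul z).const_sub (E z))
    fun x hx => hE.sub_mul_dslope_ne_zero hz (mem_ball_zero_iff.1 hx)

theorem exists_differentiableOn_eq_twoPointRatio (hx : ‖x‖ < 1) :
    ∃ V : ℂ → ℂ, DifferentiableOn ℂ V (ball 0 1) ∧ ∀ z ≠ x, V z = twoPointRatio E z x := by
  have hd := differentiableOn_dslope_of_norm_lt hE.diff hx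
  refine ⟨fun z => dslope (fun z => deriv E z - dslope E x z) x z / (E z - z * dslope E x z),
    (differentiableOn_dslope_of_norm_lt ((hE.diff.deriv isOpen_ball).sub hd) hx).div
      (hE.diff.sub (differentiableOn_id.mul hd)) fun z hz => ?_, fun z hz => ?_⟩
  · rw [dslope_comm]
    exact hE.sub_mul_dslope_ne_zero (mem_ball_zero_iff.1 hz) hx
  · beta_reduce
    rw [twoPointRatio_of_ne E hz.symm, dslope_of_ne _ hz, slope_def_field, dslope_same, sub_self,
      sub_zero, dslope_comm E x z]

theorem re_one_add_nonneg_and_norm_le_of_norm_lt (hx : ‖x‖ < 1) (hzx : ‖z‖ < ‖x‖) :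
    0 ≤ (1 + 2 * (z * x * twoPointRatio E z x)).re ∧
      ‖x * twoPointRatio E z x / (1 + z * x * twoPointRatio E z x)‖ ≤ 1 / ‖x‖ := by
  have hx0 : 0 < ‖x‖ := (norm_nonneg z).trans_lt hzx
  obtain ⟨V, hVd, hV⟩ := hE.exists_differentiableOn_eq_twoPointRatio hx
  have hW : DifferentiableOn ℂ (fun z => x * V z) (ball 0 1) := hVd.const_mul x
  have hcirc : ∀ y, ‖y‖ = ‖x‖ → 0 ≤ (1 + 2 * (y * (x * V y))).re := by
    have hne : ∀ y, ‖y‖ = ‖x‖ → y ≠ x → 0 ≤ (1 + 2 * (y * (x * V y))).re := fun y hy hyx => by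
      rw [hV y hyx, ← mul_assoc y]
      exact hE.re_one_add_twoPointRatio_nonneg_of_norm_eq (hy ▸ hx) hy.symm hyx.symm
    intro y hy
    obtain rfl | hyx := eq_or_ne y x
    · refine re_nonneg_of_forall_mem_sphere_ne (norm_pos_iff.1 hx0)
        (Q := fun z => 1 + 2 * (z * (y * V z))) ?_ hne
      have := (hW.differentiableAt (isOpen_ball.mem_nhds (mem_ball_zero_iff.2 hx))).continuousAt
      fun_prop
    · exact hne y hy hyx
  have hzne : z ≠ x := fun h => hzx.ne (congrArg norm h)
  rw [mul_assoc, ← hV z hzne]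
  exact ⟨re_one_add_two_mul_nonneg hW hx0.ne' hx hcirc hzx.le,
    norm_div_one_add_mul_le hW hx0 hx hcirc hzx.le⟩

theorem re_one_add_twoPointRatio_nonneg (hz : ‖z‖ < 1) (hx : ‖x‖ < 1) :
    0 ≤ (1 + 2 * (z * x * twoPointRatio E z x)).re := by
  obtain ⟨ρ, hρ, hρ1⟩ := exists_between (max_lt hx hz)
  obtain ⟨hxρ, hzρ⟩ := max_lt_iff.1 hρ
  have hcirc : ∀ y, ‖y‖ = ρ → 0 ≤ (1 + 2 * (y * (z * twoPointRatio E z y))).re := fun y hy => by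
    rw [← mul_assoc y, mul_comm y]
    exact (hE.re_one_add_nonneg_and_norm_le_of_norm_lt (hy ▸ hρ1) (hy ▸ hzρ)).1
  rw [mul_comm z, mul_assoc]
  exact re_one_add_two_mul_nonneg ((hE.differentiableOn_twoPointRatio hz).const_mul z)
    ((norm_nonneg x).trans_lt hxρ).ne' hρ1 hcirc hxρ.le

theorem one_add_twoPointRatio_ne_zero (hz : ‖z‖ < 1) (hx : ‖x‖ < 1) :
    1 + z * x * twoPointRatio E z x ≠ 0 :=
  one_add_ne_zero_of_re_nonneg (hE.re_one_add_twoPointRatio_nonneg hz hx)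

theorem differentiableOn_twoPointSchur (hz : ‖z‖ < 1) :
    DifferentiableOn ℂ (twoPointSchur E z) (ball 0 1) := by
  have hd := hE.differentiableOn_twoPointRatio hz
  exact hd.div (((differentiableOn_id.const_mul z).mul hd).const_add 1)
    fun x hx => hE.one_add_twoPointRatio_ne_zero hz (mem_ball_zero_iff.1 hx)

theorem norm_twoPointSchur_le_of_lt {ρ : ℝ} (hzρ : ‖z‖ < ρ) (hxρ : ‖x‖ < ρ) (hρ1 : ρ < 1) :
    ‖twoPointSchur E z x‖ ≤ 1 / ρ ^ 2 := by
  have hρ0 : 0 < ρ := (norm_nonneg z).trans_lt hzρ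
  refine Complex.norm_le_of_forall_mem_frontier_norm_le (U := ball (0 : ℂ) ρ)
    isBounded_ball (((hE.differentiableOn_twoPointSchur (hzρ.trans hρ1)).mono
      (closure_ball_subset_closedBall.trans (closedBall_subset_ball hρ1))).diffContOnCl)
    (fun y hy => ?_) (subset_closure (mem_ball_zero_iff.2 hxρ))
  rw [frontier_ball _ hρ0.ne', mem_sphere_zero_iff_norm] at hy
  have hle := (hE.re_one_add_nonneg_and_norm_le_of_norm_lt (hy ▸ hρ1) (hy ▸ hzρ)).2
  rwa [mul_div_assoc, norm_mul, hy, ← le_div_iff₀' hρ0, div_div, ← sq] at hle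

theorem norm_twoPointSchur_le_one (hz : ‖z‖ < 1) (hx : ‖x‖ < 1) : ‖twoPointSchur E z x‖ ≤ 1 := by
  have hlim : Tendsto (fun ρ : ℝ => 1 / ρ ^ 2) (𝓝[<] 1) (𝓝 1) := by
    have hcont : ContinuousAt (fun ρ : ℝ => 1 / ρ ^ 2) 1 :=
      continuousAt_const.div (continuousAt_id.pow 2) (pow_ne_zero 2 one_ne_zero)
    simpa only [one_pow, div_one] using hcont.tendsto.mono_left nhdsWithin_le_nhds
  refine ge_of_tendsto hlim ?_
  filter_upwards [Ioo_mem_nhdsLT (max_lt hz hx)] with ρ ⟨hρ, hρ1⟩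
  obtain ⟨hzρ, hxρ⟩ := max_lt_iff.1 hρ
  exact hE.norm_twoPointSchur_le_of_lt hzρ hxρ hρ1

theorem mul_one_sub_twoPointSchur_of_eq_zero (hz : ‖z‖ < 1) (hx : ‖x‖ < 1) (h0 : E z = 0) :
    E x * (1 - z ^ 2 * twoPointSchur E z x) =
      deriv E z * (x - z) * (1 - z * x * twoPointSchur E z x) := by
  obtain rfl | hxz := eq_or_ne x z
  · rw [h0, sub_self, mul_zero, zero_mul, zero_mul]
  have hsub : x - z ≠ 0 := sub_ne_zero.2 hxz
  have hquot := hE.sub_mul_dslope_ne_zero hz hx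
  have hone := hE.one_add_twoPointRatio_ne_zero hz hx
  have hratio := twoPointRatio_of_ne E hxz
  set T := twoPointRatio E z x with hT
  have hschur : twoPointSchur E z x * (1 + z * x * T) = T := div_mul_cancel₀ T hone
  rw [eq_div_iff hquot, eq_div_iff (sub_ne_zero.2 hxz.symm), dslope_of_ne _ hxz, slope_def_field,
    h0, sub_zero, zero_sub] at hratio
  have hlin : E x * (1 + z * (x - z) * T) = deriv E z * (x - z) := by
    field_simp at hratio
    linear_combination hratio
  refine mul_right_cancel₀ hone ?_
  linear_combination hlin - (E x * z ^ 2 - deriv E z * (x - z) * z * x) * hschur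

end ConcaveAtZero

section Parameter

variable {p : ℝ} {z : ℂ}

theorem norm_ofReal_lt_one (hp : 0 < p) (hp1 : p < 1) : ‖(p : ℂ)‖ < 1 := by
  rwa [Complex.norm_of_nonneg hp.le]

theorem norm_neg_ofReal_lt_one (hp : 0 < p) (hp1 : p < 1) : ‖(-p : ℂ)‖ < 1 :=
  (norm_neg _).trans_lt (norm_ofReal_lt_one hp hp1)

theorem one_sub_sq_ne_zero (hp : 0 < p) (hp1 : p < 1) : (1 - p ^ 2 : ℂ) ≠ 0 := by
  exact_mod_cast (sub_pos.2 (pow_lt_one₀ hp.le hp1 two_ne_zero)).ne'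

theorem one_add_sq_ne_zero (p : ℝ) : (1 + p ^ 2 : ℂ) ≠ 0 := by
  exact_mod_cast (show (1 + p ^ 2 : ℝ) ≠ 0 by positivity)

theorem one_sub_pow_four_ne_zero (hp : 0 < p) (hp1 : p < 1) : (1 - p ^ 4 : ℂ) ≠ 0 := by
  exact_mod_cast (sub_pos.2 (pow_lt_one₀ hp.le hp1 four_ne_zero)).ne'

theorem one_sub_mul_ne_zero (hp : 0 < p) (hp1 : p < 1) (hz : ‖z‖ ≤ 1) : 1 - p * z ≠ 0 := by
  simpa only [Complex.conj_ofReal] using one_sub_conj_mul_ne_zero (norm_ofReal_lt_one hp hp1) hz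

theorem one_sub_sq_mul_ne_zero (hp : 0 < p) (hp1 : p < 1) (hz : ‖z‖ ≤ 1) : 1 - p ^ 2 * z ≠ 0 := by
  exact_mod_cast one_sub_mul_ne_zero (pow_pos hp 2) (pow_lt_one₀ hp.le hp1 two_ne_zero) hz

theorem mobius_ofReal (p : ℝ) (z : ℂ) : mobius p z = (z - p) / (1 - p * z) := by
  rw [mobius, Complex.conj_ofReal]

theorem mobius_neg_ofReal (p : ℝ) (z : ℂ) : mobius (-p) z = (z + p) / (1 + p * z) := by
  rw [mobius, map_neg, Complex.conj_ofReal, sub_neg_eq_add, neg_mul, sub_neg_eq_add]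

theorem hasDerivAt_mobius_ofReal (hp : 0 < p) (hp1 : p < 1) (hz : ‖z‖ ≤ 1) :
    HasDerivAt (mobius p) ((1 - p ^ 2) / (1 - p * z) ^ 2) z := by
  simpa only [Complex.conj_ofReal, Complex.norm_of_nonneg hp.le] using
    hasDerivAt_mobius (norm_ofReal_lt_one hp hp1) hz

theorem hasDerivAt_mobius_neg_ofReal (hp : 0 < p) (hp1 : p < 1) (hz : ‖z‖ ≤ 1) :
    HasDerivAt (mobius (-p)) ((1 - p ^ 2) / (1 + p * z) ^ 2) z := by
  simpa only [map_neg, Complex.conj_ofReal, norm_neg, Complex.norm_of_nonneg hp.le, neg_mul,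
    sub_neg_eq_add] using hasDerivAt_mobius (norm_neg_ofReal_lt_one hp hp1) hz

theorem bijOn_mobius_neg_ofReal (hp : 0 < p) (hp1 : p < 1) :
    BijOn (mobius (-p)) puncturedDisc (ball 0 1 \ {(p : ℂ)}) := by
  have hpn := norm_ofReal_lt_one hp hp1
  refine InvOn.bijOn (f' := mobius p) ⟨fun x hx => ?_, fun z hz => ?_⟩ (fun x hx => ?_)
    fun z hz => ?_
  · exact mobius_mobius_neg hpn (mem_puncturedDisc.1 hx).1.le
  · exact mobius_neg_mobius hpn (mem_ball_zero_iff.1 hz.1).le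
  · obtain ⟨hx1, hx0⟩ := mem_puncturedDisc.1 hx
    refine ⟨mem_ball_zero_iff.2 (norm_mobius_lt_one (norm_neg_ofReal_lt_one hp hp1) hx1),
      fun h => hx0 ?_⟩
    rw [← mobius_mobius_neg hpn hx1.le, mem_singleton_iff.1 h, mobius_self]
  · have hz1 := mem_ball_zero_iff.1 hz.1
    exact mem_puncturedDisc.2 ⟨norm_mobius_lt_one hpn hz1,
      fun h => hz.2 ((mobius_eq_zero_iff hpn hz1.le).1 h)⟩

end Parameter

theorem ConcaveAtZero.exists_representation {E : ℂ → ℂ} (hE : ConcaveAtZero E) {p : ℝ} (hp : 0 < p)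
    (hp1 : p < 1) (h0 : E (-p) = 0) (hd : deriv E (-p) = -p / (1 - p ^ 2)) :
    ∃ Ω : ℂ → ℂ, DifferentiableOn ℂ Ω (ball 0 1) ∧ (∀ x ∈ ball 0 1, ‖Ω x‖ ≤ 1) ∧
      ∀ x, ‖x‖ < 1 → E x =
        -p * (x + p) * (1 + p ^ 3 * x - p * Ω x * (p + x)) / ((1 - p ^ 2) * (1 - p ^ 4)) := by
  have hpn := norm_neg_ofReal_lt_one hp hp1
  have hp2lt : p ^ 2 < 1 := pow_lt_one₀ hp.le hp1 two_ne_zero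
  have hp2n : ‖((p ^ 2 : ℝ) : ℂ)‖ < 1 := norm_ofReal_lt_one (pow_pos hp 2) hp2lt
  set H := twoPointSchur E (-p)
  have hH : ∀ {x : ℂ}, ‖x‖ < 1 → ‖H x‖ ≤ 1 := hE.norm_twoPointSchur_le_one hpn
  have hHd : DifferentiableOn ℂ H (ball 0 1) := hE.differentiableOn_twoPointSchur hpn
  refine ⟨fun x => -mobius (p ^ 2 : ℝ) (H x), fun x hx => ?_, fun x hx => ?_, fun x hx => ?_⟩
  · exact ((hasDerivAt_mobius hp2n (hH (mem_ball_zero_iff.1 hx))).differentiableAt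
      |>.comp_differentiableWithinAt x (hHd x hx)).fun_neg
  · rw [norm_neg]
    exact norm_mobius_le_one hp2n (hH (mem_ball_zero_iff.1 hx))
  have hp2 := one_sub_sq_ne_zero hp hp1
  have hp4 := one_sub_pow_four_ne_zero hp hp1
  have hden := one_sub_sq_mul_ne_zero hp hp1 (hH hx)
  have hEx := hE.mul_one_sub_twoPointSchur_of_eq_zero hpn hx h0
  rw [hd, div_mul_eq_mul_div, div_mul_eq_mul_div, eq_div_iff hp2] at hEx
  beta_reduce
  rw [mobius_ofReal, eq_div_iff (mul_ne_zero hp2 hp4), Complex.ofReal_pow]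
  field_simp
  linear_combination (1 - p ^ 4) * hEx

theorem exists_differentiableOn_eq_sub_mul {g : ℂ → ℂ} {a : ℂ} {U : Set ℂ}
    (hord : meromorphicOrderAt g a = -1) (hg : ∀ z ∈ U, z ≠ a → DifferentiableAt ℂ g z) :
    ∃ e : ℂ → ℂ, DifferentiableOn ℂ e U ∧ e a ≠ 0 ∧ ∀ z ≠ a, e z = (z - a) * g z := by
  obtain ⟨φ, hφ, hφ0, hφg⟩ := (meromorphicOrderAt_eq_int_iff (n := -1)
    (meromorphicAt_of_meromorphicOrderAt_ne_zero (by rw [hord]; decide))).1 hord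
  have hupd : ∀ {z : ℂ}, z ≠ a → update (fun z => (z - a) * g z) a (φ a) z = (z - a) * g z :=
    fun hz => update_of_ne hz _ _
  refine ⟨update (fun z => (z - a) * g z) a (φ a), fun z hz => ?_, by rwa [update_self],
    fun z hz => hupd hz⟩
  refine DifferentiableAt.differentiableWithinAt ?_
  obtain rfl | hza := eq_or_ne z a
  · refine hφ.differentiableAt.congr_of_eventuallyEq ?_
    filter_upwards [eventually_nhdsWithin_iff.1 hφg] with w hw
    obtain rfl | hwz := eq_or_ne w z
    · rw [update_self]
    · rw [hupd hwz, hw hwz, zpow_neg_one, smul_eq_mul, mul_inv_cancel_left₀ (sub_ne_zero.2 hwz)]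
  · refine ((differentiableAt_id.sub_const a).mul (hg z hz hza)).congr_of_eventuallyEq ?_
    filter_upwards [isOpen_compl_singleton.mem_nhds hza] with w hw using hupd hw

theorem coe_finitePart {f : 𝔻 → OnePoint ℂ} {z : 𝔻} (h : f z ≠ ∞) :
    (finitePart f z : OnePoint ℂ) = f z := by
  rw [finitePart, dif_pos z.norm_lt_one, Complex.UnitDisc.mk_coe]
  obtain ⟨w, hw⟩ := OnePoint.ne_infty_iff_exists.1 h
  rw [← hw]
  rfl

theorem finitePart_of_eq_coe {f : 𝔻 → OnePoint ℂ} {z : 𝔻} {w : ℂ} (h : f z = w) :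
    finitePart f z = w := by
  rw [finitePart, dif_pos z.norm_lt_one, Complex.UnitDisc.mk_coe, h]
  rfl

theorem mem_image_finitePart {f : 𝔻 → OnePoint ℂ} {a w : ℂ} (hf : ∀ z : 𝔻, f z = ∞ ↔ (z : ℂ) = a) :
    w ∈ finitePart f '' (ball 0 1 \ {a}) ↔ (w : OnePoint ℂ) ∈ range f := by
  constructor
  · rintro ⟨z, ⟨hz, hza⟩, rfl⟩
    rw [mem_ball_zero_iff] at hz
    exact ⟨.mk z hz, (coe_finitePart (z := .mk z hz) fun h => hza ((hf _).1 h)).symm⟩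
  · rintro ⟨z, hz⟩
    refine ⟨z, ⟨mem_ball_zero_iff.2 z.norm_lt_one, fun h => ?_⟩, finitePart_of_eq_coe hz⟩
    rw [(hf z).2 h] at hz
    exact OnePoint.infty_ne_coe _ hz

/-- The function `E` with `E x / x = g (mobius (-p) x)` if `e z = (z - p) * g z`. -/
def poleAtZero (p : ℝ) (e : ℂ → ℂ) (x : ℂ) : ℂ :=
  e (mobius (-p) x) * (1 + p * x) / (1 - p ^ 2)

theorem poleAtZero_neg (p : ℝ) {e : ℂ → ℂ} (he0 : e 0 = 0) : poleAtZero p e (-p) = 0 := by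
  rw [poleAtZero, mobius_self, he0, zero_mul, zero_div]

section PoleAtZero

variable {p : ℝ} {e : ℂ → ℂ} (hp : 0 < p) (hp1 : p < 1)

include hp hp1

theorem withPole_poleAtZero {g : ℂ → ℂ} {x : ℂ} (he : ∀ z ≠ (p : ℂ), e z = (z - p) * g z)
    (hx : x ∈ puncturedDisc) : withPole (poleAtZero p e) x = g (mobius (-p) x) := by
  obtain ⟨hx1, hx0⟩ := mem_puncturedDisc.1 hx
  have hp2 := one_sub_sq_ne_zero hp hp1
  have hden : 1 + x * p ≠ 0 := by
    have hneg := one_sub_mul_ne_zero hp hp1 ((norm_neg x).trans_le hx1.le)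
    rwa [mul_neg, sub_neg_eq_add, mul_comm] at hneg
  have hsub : mobius (-p) x - p = x * (1 - p ^ 2) / (1 + x * p) := by
    rw [mobius_neg_ofReal, mul_comm (p : ℂ) x]
    field_simp
    ring
  rw [withPole, poleAtZero, he _ ((bijOn_mobius_neg_ofReal hp hp1).mapsTo hx).2, hsub,
    mul_comm (p : ℂ) x]
  field_simp

theorem hasDerivAt_poleAtZero_neg {e' : ℂ} (he0 : e 0 = 0) (he : HasDerivAt e e' 0) :
    HasDerivAt (poleAtZero p e) (e' / (1 - p ^ 2)) (-p) := by
  have hp2 := one_sub_sq_ne_zero hp hp1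
  have hself : (1 + p * -p : ℂ) = 1 - p ^ 2 := by ring
  have hcomp : HasDerivAt (fun x => e (mobius (-p) x)) (e' * ((1 - p ^ 2) / (1 + p * -p) ^ 2))
      (-p) := by
    refine HasDerivAt.comp (h₂ := e) (-p : ℂ) (by rwa [mobius_self])
      (hasDerivAt_mobius_neg_ofReal hp hp1 (norm_neg_ofReal_lt_one hp hp1).le)
  refine ((hcomp.mul (((hasDerivAt_id (-p : ℂ)).const_mul (p : ℂ)).const_add 1)).div_const
    (1 - p ^ 2 : ℂ)).congr_deriv ?_
  rw [mobius_self, he0, zero_mul, add_zero, id, hself]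
  field_simp

theorem differentiableOn_poleAtZero (he : DifferentiableOn ℂ e (ball 0 1)) :
    DifferentiableOn ℂ (poleAtZero p e) (ball 0 1) := by
  have hmob : DifferentiableOn ℂ (mobius (-p)) (ball 0 1) := fun x hx =>
    (hasDerivAt_mobius_neg_ofReal hp hp1
      (mem_ball_zero_iff.1 hx).le).differentiableAt.differentiableWithinAt
  refine ((he.comp hmob fun x hx => mem_ball_zero_iff.2 ?_).mul
    ((differentiableOn_id.const_mul _).const_add 1)).div_const _
  exact norm_mobius_lt_one (norm_neg_ofReal_lt_one hp hp1) (mem_ball_zero_iff.1 hx)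

end PoleAtZero

namespace IsConcave

variable {p : ℝ} {f : 𝔻 → OnePoint ℂ} (hf : IsConcave p f) (hp : 0 < p) (hp1 : p < 1)

include hf in
theorem finitePart_zero : finitePart f 0 = 0 := finitePart_of_eq_coe hf.map_zero

include hf hp hp1

theorem eq_infty_iff {z : 𝔻} : f z = ∞ ↔ (z : ℂ) = p := by
  set p' : 𝔻 := .mk p (norm_ofReal_lt_one hp hp1)
  have hpole : f p' = ∞ := by
    by_contra h
    have hord := ((hf.meromorphic p').1 h).meromorphicOrderAt_nonneg
    rw [Complex.UnitDisc.coe_mk, hf.simple_pole] at hord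
    exact absurd hord (by decide)
  rw [← hpole, hf.injective.eq_iff, ← Complex.UnitDisc.coe_inj, Complex.UnitDisc.coe_mk]

theorem coe_finitePart_of_ne {z : 𝔻} (hz : (z : ℂ) ≠ p) : (finitePart f z : OnePoint ℂ) = f z :=
  coe_finitePart fun h => hz ((hf.eq_infty_iff hp hp1).1 h)

theorem differentiableAt_finitePart {z : ℂ} (hz : ‖z‖ < 1) (hzp : z ≠ p) :
    DifferentiableAt ℂ (finitePart f) z :=
  ((hf.meromorphic (.mk z hz)).1 fun h => hzp ((hf.eq_infty_iff hp hp1).1 h)).differentiableAt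

theorem injOn_finitePart : InjOn (finitePart f) (ball 0 1 \ {(p : ℂ)}) := by
  rintro z ⟨hz, hzp⟩ w ⟨hw, hwp⟩ h
  rw [mem_ball_zero_iff] at hz hw
  have hzw : f (.mk z hz) = f (.mk w hw) := by
    rw [← hf.coe_finitePart_of_ne hp hp1 (z := .mk z hz) hzp,
      ← hf.coe_finitePart_of_ne hp hp1 (z := .mk w hw) hwp]
    exact congrArg _ h
  exact (Complex.UnitDisc.mk_inj hz hw).1 (hf.injective hzw)

theorem convex_compl_image_finitePart :
    Convex ℝ (finitePart f '' (ball 0 1 \ {(p : ℂ)}))ᶜ := by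
  obtain ⟨K, hK, hKf⟩ := hf.convex_compl
  convert hK using 1
  ext w
  rw [mem_compl_iff, mem_image_finitePart fun _ => hf.eq_infty_iff hp hp1, ← mem_compl_iff, hKf,
    OnePoint.coe_injective.mem_set_image]

theorem concaveAtZero_poleAtZero {e : ℂ → ℂ} (hed : DifferentiableOn ℂ e (ball 0 1))
    (hep : e p ≠ 0) (he : ∀ z ≠ (p : ℂ), e z = (z - p) * finitePart f z) :
    ConcaveAtZero (poleAtZero p e) := by
  have hbij := bijOn_mobius_neg_ofReal hp hp1
  have heq : EqOn (withPole (poleAtZero p e)) (finitePart f ∘ mobius (-p)) puncturedDisc :=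
    fun x hx => withPole_poleAtZero hp hp1 he hx
  refine ⟨differentiableOn_poleAtZero hp hp1 hed, ?_, ?_, ?_⟩
  · rw [poleAtZero, mobius_zero_right, neg_neg, mul_zero, add_zero, mul_one]
    exact div_ne_zero hep (one_sub_sq_ne_zero hp hp1)
  · exact ((hf.injOn_finitePart hp hp1).comp hbij.injOn hbij.mapsTo).congr heq.symm
  · rw [heq.image_eq, image_comp, hbij.image_eq]
    exact hf.convex_compl_image_finitePart hp hp1

theorem exists_concaveAtZero : ∃ E : ℂ → ℂ, ConcaveAtZero E ∧ E (-p) = 0 ∧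
    deriv E (-p) = -p / (1 - p ^ 2) ∧
    ∀ x ∈ puncturedDisc, withPole E x = finitePart f (mobius (-p) x) := by
  obtain ⟨e, hed, hep, he⟩ := exists_differentiableOn_eq_sub_mul (U := ball 0 1) hf.simple_pole
    fun z hz => hf.differentiableAt_finitePart hp hp1 (mem_ball_zero_iff.1 hz)
  have hp0 : (0 : ℂ) ≠ p := (Complex.ofReal_ne_zero.2 hp.ne').symm
  have he0 : e 0 = 0 := by rw [he 0 hp0, hf.finitePart_zero, mul_zero]
  have he' : HasDerivAt e (-p) 0 := by
    have hf' := (hf.differentiableAt_finitePart hp hp1 (by simp) hp0).hasDerivAt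
    rw [hf.deriv_zero] at hf'
    refine ((((hasDerivAt_id (0 : ℂ)).sub_const (p : ℂ)).mul hf').congr_of_eventuallyEq
      ?_).congr_deriv ?_
    · filter_upwards [isOpen_compl_singleton.mem_nhds hp0] with w hw using he w hw
    · rw [hf.finitePart_zero, id, mul_zero, zero_add, zero_sub, mul_one]
  exact ⟨poleAtZero p e, hf.concaveAtZero_poleAtZero hp hp1 hed hep he, poleAtZero_neg p he0,
    (hasDerivAt_poleAtZero_neg hp hp1 he0 he').deriv,
    fun x hx => withPole_poleAtZero hp hp1 he hx⟩

end IsConcave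

/-- The function `rep p ω` with its pole at `p` cleared, `z ↦ (z - p) * rep p ω z`. -/
def clearedRep (p : ℝ) (ω : ℂ → ℂ) (z : ℂ) : ℂ :=
  -p * (z - p / (1 + p ^ 2) * (1 + ω z) * z ^ 2) / (1 - p * z)

section Rep

variable {p : ℝ}

theorem rep_of_eq (ω : 𝔻 → ℂ) {z : 𝔻} (hz : (z : ℂ) = p) : rep p ω z = ∞ := if_pos hz

theorem rep_of_ne (hp : 0 < p) (ω : ℂ → ℂ) {z : 𝔻} (hz : (z : ℂ) ≠ p) :
    rep p (fun z => ω z) z = (clearedRep p ω z / (z - p) : ℂ) := by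
  have hp0 : (p : ℂ) ≠ 0 := Complex.ofReal_ne_zero.2 hp.ne'
  have hsub : 1 - (z : ℂ) / p = -((z - p) / p) := by rw [sub_div, div_self hp0, neg_sub]
  rw [rep, if_neg hz, clearedRep, hsub]
  congr 1
  simp only [div_eq_mul_inv, mul_inv, inv_neg, inv_inv]
  ring

theorem rep_eq_infty_iff (hp : 0 < p) (ω : ℂ → ℂ) {z : 𝔻} :
    rep p (fun z => ω z) z = ∞ ↔ (z : ℂ) = p := by
  refine ⟨fun h => ?_, rep_of_eq _⟩
  by_contra hz
  rw [rep_of_ne hp ω hz] at h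
  exact OnePoint.coe_ne_infty _ h

theorem finitePart_rep (hp : 0 < p) (ω : ℂ → ℂ) {z : ℂ} (hz : ‖z‖ < 1) (hzp : z ≠ p) :
    finitePart (rep p fun z => ω z) z = clearedRep p ω z / (z - p) :=
  finitePart_of_eq_coe (z := .mk z hz) (rep_of_ne hp ω hzp)

theorem clearedRep_eq_sub_mul (hp : 0 < p) (ω : ℂ → ℂ) {z : ℂ} (hz : ‖z‖ < 1) (hzp : z ≠ p) :
    clearedRep p ω z = (z - p) * finitePart (rep p fun z => ω z) z := by
  rw [finitePart_rep hp ω hz hzp, mul_div_cancel₀ _ (sub_ne_zero.2 hzp)]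

theorem rep_zero (hp : 0 < p) (ω : ℂ → ℂ) : rep p (fun z => ω z) 0 = ((0 : ℂ) : OnePoint ℂ) := by
  have hp0 : ((0 : 𝔻) : ℂ) ≠ p := (Complex.ofReal_ne_zero.2 hp.ne').symm
  rw [rep_of_ne hp ω hp0, clearedRep]
  simp

theorem differentiableOn_clearedRep (hp : 0 < p) (hp1 : p < 1) {ω : ℂ → ℂ}
    (hω : DifferentiableOn ℂ ω (ball 0 1)) : DifferentiableOn ℂ (clearedRep p ω) (ball 0 1) :=
  DifferentiableOn.div (by fun_prop) (by fun_prop) fun _ hz =>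
    one_sub_mul_ne_zero hp hp1 (mem_ball_zero_iff.1 hz).le

theorem clearedRep_div_sub_eq (hp : 0 < p) (hp1 : p < 1) (ω : ℂ → ℂ) {z : ℂ} (hz : ‖z‖ < 1)
    (hzp : z ≠ p) :
    clearedRep p ω z / (z - p) =
      -p * (mobius p z + p) * (1 + p ^ 3 * mobius p z - p * ω z * (p + mobius p z)) /
        ((1 - p ^ 2) * (1 - p ^ 4)) / mobius p z := by
  have hp2 := one_sub_sq_ne_zero hp hp1
  have hp2' := one_add_sq_ne_zero p
  have hden := one_sub_mul_ne_zero hp hp1 hz.le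
  have hzp' : z - p ≠ 0 := sub_ne_zero.2 hzp
  have hadd : mobius p z + p = z * (1 - p ^ 2) / (1 - p * z) := by
    rw [mobius_ofReal, div_add' _ _ _ hden]
    ring
  have hnum : 1 + p ^ 3 * mobius p z - p * ω z * (p + mobius p z) =
      (1 - p ^ 2) * (1 + p ^ 2 - p * z * (1 + ω z)) / (1 - p * z) := by
    rw [add_comm (p : ℂ), hadd, mobius_ofReal, eq_div_iff hden]
    field_simp
    ring
  have hp4 : (1 - p ^ 4 : ℂ) = (1 - p ^ 2) * (1 + p ^ 2) := by ring
  rw [hnum, hadd, hp4, mobius_ofReal, clearedRep]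
  field_simp

end Rep

theorem IsConcave.exists_eq_rep {p : ℝ} {f : 𝔻 → OnePoint ℂ} (hf : IsConcave p f) (hp : 0 < p)
    (hp1 : p < 1) : ∃ ω : ℂ → ℂ, DifferentiableOn ℂ ω (ball 0 1) ∧
      (∀ z ∈ ball 0 1, ‖ω z‖ ≤ 1) ∧ f = rep p fun z => ω z := by
  obtain ⟨E, hE, hE0, hE', hEf⟩ := hf.exists_concaveAtZero hp hp1
  obtain ⟨Ω, hΩ, hΩ1, hΩE⟩ := hE.exists_representation hp hp1 hE0 hE'
  have hpn := norm_ofReal_lt_one hp hp1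
  have hmaps : MapsTo (mobius p) (ball 0 1) (ball 0 1) := fun z hz =>
    mem_ball_zero_iff.2 (norm_mobius_lt_one hpn (mem_ball_zero_iff.1 hz))
  have hmob : DifferentiableOn ℂ (mobius p) (ball 0 1) := fun z hz =>
    (hasDerivAt_mobius_ofReal hp hp1
      (mem_ball_zero_iff.1 hz).le).differentiableAt.differentiableWithinAt
  refine ⟨Ω ∘ mobius p, hΩ.comp hmob hmaps, fun z hz => hΩ1 _ (hmaps hz), funext fun z => ?_⟩
  have hz := z.norm_lt_one
  obtain hzp | hzp := eq_or_ne (z : ℂ) p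
  · rw [(hf.eq_infty_iff hp hp1).2 hzp, rep_of_eq _ hzp]
  have hx : mobius p z ∈ puncturedDisc := mem_puncturedDisc.2
    ⟨norm_mobius_lt_one hpn hz, fun h => hzp ((mobius_eq_zero_iff hpn hz.le).1 h)⟩
  rw [rep_of_ne hp _ hzp, clearedRep_div_sub_eq hp hp1 _ hz hzp,
    ← hf.coe_finitePart_of_ne hp hp1 hzp, ← mobius_neg_mobius hpn hz.le, ← hEf _ hx, withPole,
    hΩE _ (mem_puncturedDisc.1 hx).1, mobius_neg_mobius hpn hz.le, comp_apply]

section Laurent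

variable {p : ℝ} {f : 𝔻 → OnePoint ℂ}

theorem hasLaurentExpansion_iff {a : ℤ → ℂ} :
    HasLaurentExpansion p f a ↔ (∀ n : ℤ, n < -1 → a n = 0) ∧
      ∀ z : ℂ, 0 < ‖z - (p : ℂ)‖ → ‖z - (p : ℂ)‖ < 1 - p →
        HasSum (fun n : ℕ => (z - (p : ℂ)) ^ n * a (n - 1)) ((z - p) * finitePart f z) := by
  refine and_congr_right fun h0 => forall_congr' fun z => forall_congr' fun hz =>
    forall_congr' fun _ => ?_
  have hz0 : z - p ≠ 0 := norm_pos_iff.1 hz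
  have hinj : Injective fun n : ℕ => (n : ℤ) - 1 := fun m n h => by
    simpa only [sub_left_inj, Nat.cast_inj] using h
  have hsupp : ∀ n ∉ range (fun n : ℕ => (n : ℤ) - 1), a n * (z - (p : ℂ)) ^ n = 0 := by
    intro n hn
    rw [h0 n, zero_mul]
    by_contra! h
    exact hn ⟨(n + 1).toNat, show ((n + 1).toNat : ℤ) - 1 = n by omega⟩
  rw [← hinj.hasSum_iff hsupp, ← hasSum_mul_left_iff hz0]
  refine Iff.of_eq (congrArg (HasSum · _) (funext fun n => ?_))
  rw [comp_apply, zpow_sub₀ hz0, zpow_natCast, zpow_one]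
  field_simp

theorem eq_zero_of_hasSum_zero {c : ℕ → ℂ} {r : ℝ} (hr : 0 < r)
    (h : ∀ w : ℂ, 0 < ‖w‖ → ‖w‖ < r → HasSum (fun n => w ^ n * c n) 0) : c = 0 := by
  set g : ℂ → ℂ := update 0 0 (c 0)
  have hps : HasFPowerSeriesAt g (FormalMultilinearSeries.ofScalars ℂ c) 0 := by
    rw [hasFPowerSeriesAt_iff]
    filter_upwards [ball_mem_nhds (0 : ℂ) hr] with w hw
    simp only [FormalMultilinearSeries.coeff_ofScalars, zero_add, smul_eq_mul]
    obtain rfl | hw0 := eq_or_ne w 0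
    · rw [show g 0 = 0 ^ 0 * c 0 by rw [pow_zero, one_mul]; exact update_self ..]
      exact hasSum_single (f := fun n => (0 : ℂ) ^ n * c n) 0 fun n hn => by
        rw [zero_pow hn, zero_mul]
    · rw [show g w = 0 from update_of_ne hw0 ..]
      exact h w (norm_pos_iff.2 hw0) (mem_ball_zero_iff.1 hw)
  have hg : ∀ᶠ w in 𝓝[≠] 0, g w = 0 := by
    filter_upwards [self_mem_nhdsWithin] with w hw using update_of_ne hw ..
  have hg0 : g =ᶠ[𝓝 0] 0 := hps.analyticAt.frequently_zero_iff_eventually_zero.1 hg.frequently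
  funext n
  have hcoeff : (FormalMultilinearSeries.ofScalars ℂ c).coeff n = 0 := by
    rw [(hps.congr hg0).eq_zero]
    rfl
  rwa [FormalMultilinearSeries.coeff_ofScalars] at hcoeff

theorem HasLaurentExpansion.unique (hp1 : p < 1) {a b : ℤ → ℂ} (ha : HasLaurentExpansion p f a)
    (hb : HasLaurentExpansion p f b) : a = b := by
  rw [hasLaurentExpansion_iff] at ha hb
  have hab : (fun n : ℕ => a (n - 1) - b (n - 1)) = 0 := by
    refine eq_zero_of_hasSum_zero (sub_pos.2 hp1) fun w hw hw1 => ?_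
    rw [← add_sub_cancel_right w (p : ℂ)] at hw hw1
    simpa only [mul_sub, sub_self, add_sub_cancel_right] using (ha.2 _ hw hw1).sub (hb.2 _ hw hw1)
  funext n
  obtain hn | hn := lt_or_ge n (-1)
  · rw [ha.1 n hn, hb.1 n hn]
  · have hn' : ((n + 1).toNat : ℤ) - 1 = n := by omega
    simpa only [hn', Pi.zero_apply, sub_eq_zero] using congrFun hab (n + 1).toNat

variable {e : ℂ → ℂ} (hp : 0 < p) (hed : DifferentiableOn ℂ e (ball 0 1))
  (he : ∀ z : ℂ, ‖z‖ < 1 → z ≠ p → e z = (z - p) * finitePart f z)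

include hp hed he

theorem hasLaurentExpansion_iteratedDeriv : HasLaurentExpansion p f fun n : ℤ =>
    if n < -1 then 0 else ((n + 1).toNat.factorial : ℂ)⁻¹ * iteratedDeriv (n + 1).toNat e p := by
  rw [hasLaurentExpansion_iff]
  refine ⟨fun n hn => if_pos hn, fun z hz hz1 => ?_⟩
  have hsub : ball (p : ℂ) (1 - p) ⊆ ball 0 1 := by
    refine ball_subset_ball' ?_
    rw [dist_zero_right, Complex.norm_of_nonneg hp.le, sub_add_cancel]
  have hzb : z ∈ ball (p : ℂ) (1 - p) := by rwa [mem_ball, dist_eq_norm]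
  have htaylor := Complex.hasSum_taylorSeries_on_ball (hed.mono hsub) hzb
  rw [he z (mem_ball_zero_iff.1 (hsub hzb)) (sub_ne_zero.1 (norm_pos_iff.1 hz))] at htaylor
  refine (congrArg (HasSum · _) (funext fun n => ?_)).mp htaylor
  rw [if_neg (by omega : ¬ (n : ℤ) - 1 < -1), sub_add_cancel, Int.toNat_natCast, smul_eq_mul,
    smul_eq_mul]
  ring

theorem hasLaurentExpansion_iff_eq_laurentCoeff (hp1 : p < 1) (a : ℤ → ℂ) :
    HasLaurentExpansion p f a ↔ a = laurentCoeff p f := by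
  have hex : ∃ a, HasLaurentExpansion p f a := ⟨_, hasLaurentExpansion_iteratedDeriv hp hed he⟩
  have hcoeff : HasLaurentExpansion p f (laurentCoeff p f) := by
    rw [laurentCoeff, dif_pos hex]
    exact hex.choose_spec
  exact ⟨fun h => h.unique hp1 hcoeff, fun h => h ▸ hcoeff⟩

theorem laurentCoeff_zero (hp1 : p < 1) : laurentCoeff p f 0 = deriv e p := by
  rw [← (hasLaurentExpansion_iff_eq_laurentCoeff hp hed he hp1 _).1
    (hasLaurentExpansion_iteratedDeriv hp hed he)]
  simp [iteratedDeriv_one]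

end Laurent

theorem deriv_clearedRep {p : ℝ} (hp : 0 < p) (hp1 : p < 1) {ω : ℂ → ℂ}
    (hω : DifferentiableAt ℂ ω p) :
    deriv (clearedRep p ω) p = p / (1 - p ^ 2) *
      (-(1 - p ^ 2 + p ^ 4) / (1 - p ^ 4) + p ^ 2 * (2 - p ^ 2) / (1 - p ^ 4) * ω p +
        p ^ 3 / (1 + p ^ 2) * deriv ω p) := by
  have hp2 := one_sub_sq_ne_zero hp hp1
  have hp2' := one_add_sq_ne_zero p
  have hp4 : (1 - p ^ 4 : ℂ) = (1 - p ^ 2) * (1 + p ^ 2) := by ring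
  have hself : (1 - p * p : ℂ) = 1 - p ^ 2 := by ring
  have hderiv : HasDerivAt (clearedRep p ω) _ p :=
    ((((hasDerivAt_id (p : ℂ)).sub (((hω.hasDerivAt.const_add 1).const_mul
      (p / (1 + p ^ 2) : ℂ)).mul ((hasDerivAt_id (p : ℂ)).pow 2))).const_mul (-p : ℂ)).div
      (((hasDerivAt_id (p : ℂ)).const_mul (p : ℂ)).const_sub 1) (hself ▸ hp2))
  rw [hderiv.deriv]
  simp only [id, Pi.pow_apply, Pi.sub_apply, Pi.mul_apply]
  rw [hself, hp4]
  field_simp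
  ring

section Joukowski

/-- The Joukowski map with parameter `δ`, normalized to have its pole at `0`; on the unit circle it
is the real-linear map `u ↦ conj u + δ * u`. -/
def joukowski (δ x : ℂ) : ℂ := x⁻¹ + δ * x

/-- The full ellipse bounded by the image of the unit circle under `joukowski δ`. -/
def joukowskiEllipse (δ : ℂ) : Set ℂ := (fun u => conj u + δ * u) '' closedBall 0 1

variable {δ : ℂ}

theorem convex_joukowskiEllipse (δ : ℂ) : Convex ℝ (joukowskiEllipse δ) :=
  (convex_closedBall 0 1).linear_image (Complex.conjAe.toLinearMap + LinearMap.mulLeft ℝ δ)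

theorem injOn_joukowski (hδ : ‖δ‖ ≤ 1) : InjOn (joukowski δ) puncturedDisc := by
  intro x hx y hy h
  obtain ⟨hx1, hx0⟩ := mem_puncturedDisc.1 hx
  obtain ⟨hy1, hy0⟩ := mem_puncturedDisc.1 hy
  have hprod : (x - y) * (1 - δ * x * y) = 0 := by
    rw [joukowski, joukowski] at h
    field_simp at h
    linear_combination -h
  have hnorm : ‖δ * x * y‖ < 1 := by
    rw [norm_mul, norm_mul]
    exact mul_lt_one_of_nonneg_of_lt_one_right
      (mul_le_one₀ hδ (norm_nonneg x) hx1.le) (norm_nonneg y) hy1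
  exact sub_eq_zero.1 ((mul_eq_zero.1 hprod).resolve_right
    (isUnit_one_sub_of_norm_lt_one hnorm).ne_zero)

theorem joukowski_notMem_joukowskiEllipse (hδ : ‖δ‖ ≤ 1) {x : ℂ} (hx : x ∈ puncturedDisc) :
    joukowski δ x ∉ joukowskiEllipse δ := by
  rintro ⟨u, hu, hux : conj u + δ * u = x⁻¹ + δ * x⟩
  obtain ⟨hx1, hx0⟩ := mem_puncturedDisc.1 hx
  rw [mem_closedBall_zero_iff] at hu
  have heq : 1 - conj u * x = x * δ * (u - x) := by
    field_simp at hux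
    linear_combination -hux
  have hsub : ‖x - u‖ ≤ ‖1 - conj u * x‖ := by
    rw [← sq_le_sq₀ (norm_nonneg _) (norm_nonneg _), ← sub_nonneg,
      norm_sq_one_sub_conj_mul_sub_norm_sq_sub]
    exact mul_nonneg (sub_nonneg.2 (pow_le_one₀ (norm_nonneg u) hu))
      (sub_nonneg.2 (pow_le_one₀ (norm_nonneg x) hx1.le))
  have hux1 : ‖conj u * x‖ < 1 := by
    rw [norm_mul, RCLike.norm_conj]
    exact mul_lt_one_of_nonneg_of_lt_one_right hu (norm_nonneg x) hx1
  have hpos : 0 < ‖1 - conj u * x‖ :=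
    norm_pos_iff.2 (isUnit_one_sub_of_norm_lt_one hux1).ne_zero
  have hlt : ‖x * δ‖ < 1 := by
    rw [norm_mul]
    exact mul_lt_one_of_nonneg_of_lt_one_left (norm_nonneg x) hx1 hδ
  refine lt_irrefl ‖1 - conj u * x‖ ?_
  calc ‖1 - conj u * x‖ = ‖x * δ‖ * ‖x - u‖ := by rw [heq, norm_mul, norm_sub_rev]
    _ ≤ ‖x * δ‖ * ‖1 - conj u * x‖ := by gcongr
    _ < ‖1 - conj u * x‖ := mul_lt_of_lt_one_left hpos hlt

theorem add_mem_joukowskiEllipse_mul {a b : ℂ} (ha : ‖a‖ ≤ 1) (hb : ‖b‖ ≤ 1) :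
    a + b ∈ joukowskiEllipse (a * b) := by
  obtain hab | hab := (mul_le_one₀ ha (norm_nonneg b) hb).eq_or_lt
  · have ha1 : ‖a‖ = 1 := le_antisymm ha (by nlinarith [norm_nonneg a])
    refine ⟨conj a, mem_closedBall_zero_iff.2 (by rwa [RCLike.norm_conj]), ?_⟩
    have haa : a * conj a = 1 := by rw [Complex.mul_conj', ha1, Complex.ofReal_one, one_pow]
    simp only [Complex.conj_conj]
    linear_combination b * haa
  have hpos : 0 < 1 - (‖a‖ * ‖b‖) ^ 2 :=
    sub_pos.2 (pow_lt_one₀ (by positivity) hab two_ne_zero)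
  have ha2 : 0 ≤ 1 - ‖a‖ ^ 2 := sub_nonneg.2 (pow_le_one₀ (norm_nonneg a) ha)
  have hb2 : 0 ≤ 1 - ‖b‖ ^ 2 := sub_nonneg.2 (pow_le_one₀ (norm_nonneg b) hb)
  refine ⟨(conj a * (1 - ‖b‖ ^ 2 : ℝ) + conj b * (1 - ‖a‖ ^ 2 : ℝ)) /
    (1 - (‖a‖ * ‖b‖) ^ 2 : ℝ), mem_closedBall_zero_iff.2 ?_, ?_⟩
  · rw [norm_div, Complex.norm_of_nonneg hpos.le, div_le_one hpos]
    calc _ ≤ ‖a‖ * (1 - ‖b‖ ^ 2) + ‖b‖ * (1 - ‖a‖ ^ 2) := by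
          refine (norm_add_le _ _).trans_eq ?_
          rw [norm_mul, norm_mul, RCLike.norm_conj, RCLike.norm_conj, Complex.norm_of_nonneg hb2,
            Complex.norm_of_nonneg ha2]
      _ = 1 - (‖a‖ * ‖b‖) ^ 2 - (1 - ‖a‖) * (1 - ‖b‖) * (1 - ‖a‖ * ‖b‖) := by ring
      _ ≤ 1 - (‖a‖ * ‖b‖) ^ 2 := sub_le_self _ (mul_nonneg
          (mul_nonneg (sub_nonneg.2 ha) (sub_nonneg.2 hb)) (sub_nonneg.2 hab.le))
  · have hne : (1 - (‖a‖ * ‖b‖) ^ 2 : ℂ) ≠ 0 := by exact_mod_cast hpos.ne'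
    have haa := Complex.mul_conj' a
    have hbb := Complex.mul_conj' b
    simp only [map_div₀, map_add, map_mul, Complex.conj_conj, Complex.conj_ofReal]
    rw [mul_div_assoc', ← add_div]
    push_cast
    rw [div_eq_iff hne]
    linear_combination (b * (1 - (‖b‖ : ℂ) ^ 2)) * haa + (a * (1 - (‖a‖ : ℂ) ^ 2)) * hbb

theorem joukowski_mul_inv {a b : ℂ} (ha : a ≠ 0) : joukowski (a * b) a⁻¹ = a + b := by
  rw [joukowski, inv_inv, mul_comm a, mul_inv_cancel_right₀ ha]

theorem inv_mem_puncturedDisc {a : ℂ} (ha : 1 < ‖a‖) : a⁻¹ ∈ puncturedDisc := by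
  refine mem_puncturedDisc.2 ⟨?_, inv_ne_zero (norm_pos_iff.1 (one_pos.trans ha))⟩
  rw [norm_inv]
  exact inv_lt_one_of_one_lt₀ ha

-- `joukowski δ x = w` is a quadratic equation for `x⁻¹`, whose roots have product `δ` and sum `w`.
theorem image_joukowski (hδ : ‖δ‖ ≤ 1) :
    joukowski δ '' puncturedDisc = (joukowskiEllipse δ)ᶜ := by
  refine Subset.antisymm (image_subset_iff.2 fun x hx =>
    joukowski_notMem_joukowskiEllipse hδ hx) fun w hw => ?_
  obtain ⟨s, hs⟩ := IsAlgClosed.exists_pow_nat_eq (w ^ 2 - 4 * δ) two_pos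
  obtain ⟨a, b, rfl, rfl⟩ : ∃ a b : ℂ, a + b = w ∧ a * b = δ :=
    ⟨(w + s) / 2, (w - s) / 2, by ring, by linear_combination -hs / 4⟩
  obtain ha | ha := lt_or_ge 1 ‖a‖
  · exact ⟨a⁻¹, inv_mem_puncturedDisc ha, joukowski_mul_inv (norm_pos_iff.1 (one_pos.trans ha))⟩
  obtain hb | hb := lt_or_ge 1 ‖b‖
  · refine ⟨b⁻¹, inv_mem_puncturedDisc hb, ?_⟩
    rw [mul_comm, joukowski_mul_inv (norm_pos_iff.1 (one_pos.trans hb)), add_comm]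
  · exact absurd (add_mem_joukowskiEllipse_mul ha hb) hw

end Joukowski

theorem deriv_finitePart_rep_zero {p : ℝ} (hp : 0 < p) {ω : ℂ → ℂ}
    (hω : DifferentiableOn ℂ ω (ball 0 1)) :
    deriv (finitePart (rep p fun z => ω z)) 0 = 1 := by
  have hp0 : (p : ℂ) ≠ 0 := Complex.ofReal_ne_zero.2 hp.ne'
  have hball : ball (0 : ℂ) 1 ∈ 𝓝 (0 : ℂ) := ball_mem_nhds 0 one_pos
  have heq : finitePart (rep p fun z => ω z) =ᶠ[𝓝 0] fun z => z * ((1 - p / (1 + p ^ 2) *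
      (1 + ω z) * z) * (-p / ((1 - p * z) * (z - p)))) := by
    filter_upwards [hball, isOpen_compl_singleton.mem_nhds hp0.symm] with z hz hzp
    rw [finitePart_rep hp ω (mem_ball_zero_iff.1 hz) hzp, clearedRep, div_div]
    ring
  have hd : DifferentiableAt ℂ (fun z => (1 - p / (1 + p ^ 2) * (1 + ω z) * z) *
      (-p / ((1 - p * z) * (z - p)))) 0 := by
    have hω0 := hω.differentiableAt hball
    fun_prop (disch := simpa using hp0)
  refine (heq.deriv_eq.trans ((hasDerivAt_id (0 : ℂ)).mul hd.hasDerivAt).deriv).trans ?_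
  simp [hp0]

section RepMem

variable {p : ℝ} {ω : ℂ → ℂ} (hp : 0 < p) (hp1 : p < 1)
  (hω : DifferentiableOn ℂ ω (ball 0 1))

include hp hp1

theorem clearedRep_ne_zero (hωp : ‖ω p‖ ≤ 1) : clearedRep p ω p ≠ 0 := by
  have hp0 : (p : ℂ) ≠ 0 := Complex.ofReal_ne_zero.2 hp.ne'
  have hp2' := one_add_sq_ne_zero p
  have heq : clearedRep p ω p = -p ^ 2 * (1 - p ^ 2 * ω p) / ((1 + p ^ 2) * (1 - p * p)) := by
    rw [clearedRep, ← div_div]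
    congr 1
    field_simp
    ring
  rw [heq]
  exact div_ne_zero
    (mul_ne_zero (neg_ne_zero.2 (pow_ne_zero 2 hp0)) (one_sub_sq_mul_ne_zero hp hp1 hωp))
    (mul_ne_zero hp2' (one_sub_mul_ne_zero hp hp1 (norm_ofReal_lt_one hp hp1).le))

include hω

theorem meromorphicOrderAt_finitePart_rep (hωp : ‖ω p‖ ≤ 1) :
    meromorphicOrderAt (finitePart (rep p fun z => ω z)) p = -1 := by
  have hball : ball (0 : ℂ) 1 ∈ 𝓝 (p : ℂ) :=
    isOpen_ball.mem_nhds (mem_ball_zero_iff.2 (norm_ofReal_lt_one hp hp1))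
  have han : AnalyticAt ℂ (clearedRep p ω) p :=
    (differentiableOn_clearedRep hp hp1 hω).analyticAt hball
  have heq : ∀ᶠ z in 𝓝[≠] (p : ℂ), finitePart (rep p fun z => ω z) z =
      (z - p) ^ (-1 : ℤ) • clearedRep p ω z := by
    filter_upwards [mem_nhdsWithin_of_mem_nhds hball, self_mem_nhdsWithin] with z hz hzp
    rw [finitePart_rep hp ω (mem_ball_zero_iff.1 hz) hzp, zpow_neg_one, smul_eq_mul,
      inv_mul_eq_div]
  have hmer : MeromorphicAt (finitePart (rep p fun z => ω z)) p :=
    ((((MeromorphicAt.id _).sub (MeromorphicAt.const _ _)).zpow (-1)).smul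
      han.meromorphicAt).congr (heq.mono fun _ h => h.symm)
  exact (meromorphicOrderAt_eq_int_iff (n := -1) hmer).2
    ⟨_, han, clearedRep_ne_zero hp hp1 hωp, heq⟩

theorem isMeromorphic_rep (hωp : ‖ω p‖ ≤ 1) : IsMeromorphic (rep p fun z => ω z) := by
  refine fun z => ⟨fun hz => ?_, fun hz => ?_⟩
  · have hzp : (z : ℂ) ≠ p := mt (rep_eq_infty_iff hp ω).2 hz
    have hd : DifferentiableOn ℂ (finitePart (rep p fun z => ω z)) (ball 0 1 \ {(p : ℂ)}) :=
      (((differentiableOn_clearedRep hp hp1 hω).mono sdiff_subset).div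
        (differentiableOn_id.sub_const _) fun w hw => sub_ne_zero.2 hw.2).congr fun w hw =>
        finitePart_rep hp ω (mem_ball_zero_iff.1 hw.1) hw.2
    exact hd.analyticAt ((isOpen_ball.sdiff isClosed_singleton).mem_nhds
      ⟨mem_ball_zero_iff.2 z.norm_lt_one, hzp⟩)
  · have hord := meromorphicOrderAt_finitePart_rep hp hp1 hω hωp
    rw [(rep_eq_infty_iff hp ω).1 hz]
    exact ⟨meromorphicAt_of_meromorphicOrderAt_ne_zero (by rw [hord]; decide),
      by rw [hord]; decide⟩

end RepMem

theorem injective_of_injOn_finitePart {f : 𝔻 → OnePoint ℂ} {a : ℂ}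
    (hf : ∀ z : 𝔻, f z = ∞ ↔ (z : ℂ) = a) (hinj : InjOn (finitePart f) (ball 0 1 \ {a})) :
    Injective f := by
  intro z w hzw
  have hiff : (z : ℂ) = a ↔ (w : ℂ) = a := by rw [← hf, hzw, hf]
  apply Complex.UnitDisc.coe_injective
  by_cases hz : (z : ℂ) = a
  · rw [hz, hiff.1 hz]
  · have hval : finitePart f z = finitePart f w := OnePoint.coe_injective <| by
      rw [coe_finitePart (mt (hf z).1 hz), coe_finitePart (mt (hf w).1 (mt hiff.2 hz)), hzw]
    exact hinj ⟨mem_ball_zero_iff.2 z.norm_lt_one, hz⟩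
      ⟨mem_ball_zero_iff.2 w.norm_lt_one, mt hiff.2 hz⟩ hval

theorem compl_range_eq_coe_image {f : 𝔻 → OnePoint ℂ} {p : 𝔻}
    (hf : ∀ z : 𝔻, f z = ∞ ↔ (z : ℂ) = p) :
    (range f)ᶜ = (↑) '' (finitePart f '' (ball 0 1 \ {(p : ℂ)}))ᶜ := by
  ext w
  induction w using OnePoint.rec with
  | infty =>
    exact iff_of_false (fun h => h ⟨p, (hf p).2 rfl⟩)
      fun ⟨w, _, hw⟩ => OnePoint.coe_ne_infty w hw
  | coe w =>
    rw [OnePoint.coe_injective.mem_set_image, mem_compl_iff, mem_compl_iff, mem_image_finitePart hf]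

section RepConst

variable {p : ℝ} {c : ℂ} (hp : 0 < p) (hp1 : p < 1) (hc : ‖c‖ ≤ 1)

include hp hp1 hc

theorem exists_eqOn_finitePart_rep_const_joukowski : ∃ α β δ : ℂ, α ≠ 0 ∧ ‖δ‖ ≤ 1 ∧
    EqOn (finitePart (rep p fun _ => c) ∘ mobius (-p)) (fun x => β + α * joukowski δ x)
      puncturedDisc := by
  have hpn := norm_ofReal_lt_one hp hp1
  have hp0 : (p : ℂ) ≠ 0 := Complex.ofReal_ne_zero.2 hp.ne'
  have hp2 := one_sub_sq_ne_zero hp hp1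
  have hcp := one_sub_sq_mul_ne_zero hp hp1 hc
  have hp4 := one_sub_pow_four_ne_zero hp hp1
  have hD := mul_ne_zero hp2 hp4
  refine ⟨-p ^ 2 * (1 - p ^ 2 * c) / ((1 - p ^ 2) * (1 - p ^ 4)),
    -p * (1 + p ^ 4 - 2 * c * p ^ 2) / ((1 - p ^ 2) * (1 - p ^ 4)),
    -mobius (p ^ 2 : ℝ) c, ?_, ?_, fun x hx => ?_⟩
  · exact div_ne_zero (mul_ne_zero (neg_ne_zero.2 (pow_ne_zero 2 hp0)) hcp) hD
  · rw [norm_neg]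
    exact norm_mobius_le_one
      (norm_ofReal_lt_one (pow_pos hp 2) (pow_lt_one₀ hp.le hp1 two_ne_zero)) hc
  · obtain ⟨hz, hzp⟩ := (bijOn_mobius_neg_ofReal hp hp1).mapsTo hx
    obtain ⟨hx1, hx0⟩ := mem_puncturedDisc.1 hx
    rw [mem_ball_zero_iff] at hz
    rw [comp_apply, finitePart_rep hp (fun _ => c) hz hzp,
      clearedRep_div_sub_eq hp hp1 _ hz hzp, mobius_mobius_neg hpn hx1.le]
    change _ = _ + _ * (x⁻¹ + -mobius (p ^ 2 : ℝ) c * x)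
    rw [mobius_ofReal, Complex.ofReal_pow]
    field_simp
    ring

theorem injective_rep_const : Injective (rep p fun _ => c) := by
  obtain ⟨α, β, δ, hα, hδ, heq⟩ := exists_eqOn_finitePart_rep_const_joukowski hp hp1 hc
  have haff : Injective fun w => β + α * w :=
    (add_right_injective β).comp (mul_right_injective₀ hα)
  have hinj : InjOn (finitePart (rep p fun _ => c) ∘ mobius (-p)) puncturedDisc :=
    (haff.injOn.comp (injOn_joukowski hδ) (mapsTo_univ _ _)).congr heq.symm
  refine injective_of_injOn_finitePart (fun _ => rep_eq_infty_iff hp fun _ => c) ?_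
  rw [← (bijOn_mobius_neg_ofReal hp hp1).image_eq]
  exact hinj.image_of_comp

theorem exists_convex_compl_range_rep_const : ∃ K : Set ℂ, Convex ℝ K ∧
    (range (rep p fun _ => c))ᶜ = (fun w : ℂ => (w : OnePoint ℂ)) '' K := by
  obtain ⟨α, β, δ, hα, hδ, heq⟩ := exists_eqOn_finitePart_rep_const_joukowski hp hp1 hc
  have haff : Bijective fun w => β + α * w :=
    (AddGroup.addLeft_bijective β).comp (mulLeft_bijective₀ α hα)
  have himage : (finitePart (rep p fun _ => c) '' (ball 0 1 \ {(p : ℂ)}))ᶜ =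
      (fun w => β + α * w) '' joukowskiEllipse δ := by
    rw [← (bijOn_mobius_neg_ofReal hp hp1).image_eq, ← image_comp, heq.image_eq,
      ← image_image (fun w => β + α * w) (joukowski δ), image_joukowski hδ,
      image_compl_eq haff, compl_compl]
  refine ⟨_, ?_, compl_range_eq_coe_image (p := .mk p (norm_ofReal_lt_one hp hp1))
    fun _ => rep_eq_infty_iff hp fun _ => c⟩
  rw [Complex.UnitDisc.coe_mk, himage, ← image_image (β + ·) (α * ·)]
  exact ((convex_joukowskiEllipse δ).linear_image (LinearMap.mulLeft ℝ α)).translate β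

theorem isConcave_rep_const : IsConcave p (rep p fun _ => c) where
  meromorphic := isMeromorphic_rep (ω := fun _ => c) hp hp1 (differentiableOn_const c) hc
  simple_pole :=
    meromorphicOrderAt_finitePart_rep (ω := fun _ => c) hp hp1 (differentiableOn_const c) hc
  map_zero := rep_zero hp fun _ => c
  deriv_zero := deriv_finitePart_rep_zero (ω := fun _ => c) hp (differentiableOn_const c)
  injective := injective_rep_const hp hp1 hc
  convex_compl := exists_convex_compl_range_rep_const hp hp1 hc

end RepConst

/-- The affine coordinate in which the disc of values of `a₀` is centred at the origin. -/
def discCoord (p : ℝ) (w : ℂ) : ℂ :=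
  ((1 - p ^ 2) / p : ℝ) * w + ((1 - p ^ 2 + p ^ 4) / (1 - p ^ 4) : ℝ)

/-- The radius of the disc of values of `a₀` in the coordinate `discCoord p`. -/
def discRadius (p : ℝ) : ℝ := p ^ 2 * (2 - p ^ 2) / (1 - p ^ 4)

theorem image_exp_I_mul_Icc :
    (fun θ : ℝ => Complex.exp (Complex.I * θ)) '' Icc 0 (2 * Real.pi) = sphere 0 1 := by
  have hper : Periodic (fun θ : ℝ => Complex.exp (Complex.I * θ)) (2 * Real.pi) := fun θ => by
    beta_reduce
    rw [Complex.ofReal_add, mul_add, Complex.exp_add, Complex.ofReal_mul, Complex.ofReal_ofNat,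
      mul_comm Complex.I (2 * _), Complex.exp_two_pi_mul_I, mul_one]
  have himage := hper.image_Icc Real.two_pi_pos 0
  rw [zero_add] at himage
  rw [himage]
  simpa only [mul_comm] using Complex.range_exp_mul_I

section Coefficient

variable {p : ℝ} (hp : 0 < p) (hp1 : p < 1)

include hp hp1

theorem discRadius_pos : 0 < discRadius p := by
  have hp2 : p ^ 2 < 1 := pow_lt_one₀ hp.le hp1 two_ne_zero
  have hp4 : p ^ 4 < 1 := pow_lt_one₀ hp.le hp1 four_ne_zero
  exact div_pos (mul_pos (pow_pos hp 2) (by linarith)) (sub_pos.2 hp4)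

theorem injective_discCoord : Injective (discCoord p) := by
  have hp2 : p ^ 2 < 1 := pow_lt_one₀ hp.le hp1 two_ne_zero
  exact (add_left_injective _).comp <| mul_right_injective₀ <|
    Complex.ofReal_ne_zero.2 (div_pos (sub_pos.2 hp2) hp).ne'

theorem IsConcave.hasLaurentExpansion_iff {f : 𝔻 → OnePoint ℂ} (hf : IsConcave p f) (a : ℤ → ℂ) :
    HasLaurentExpansion p f a ↔ a = laurentCoeff p f := by
  obtain ⟨ω, hω, -, rfl⟩ := hf.exists_eq_rep hp hp1
  exact hasLaurentExpansion_iff_eq_laurentCoeff hp (differentiableOn_clearedRep hp hp1 hω)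
    (fun _ hz hzp => clearedRep_eq_sub_mul hp ω hz hzp) hp1 a

theorem discCoord_laurentCoeff_rep {ω : ℂ → ℂ} (hω : DifferentiableOn ℂ ω (ball 0 1)) :
    discCoord p (laurentCoeff p (rep p fun z => ω z) 0) =
      discRadius p * ω p + (p ^ 3 / (1 + p ^ 2) : ℝ) * deriv ω p := by
  have hpb : ball (0 : ℂ) 1 ∈ 𝓝 (p : ℂ) :=
    isOpen_ball.mem_nhds (mem_ball_zero_iff.2 (norm_ofReal_lt_one hp hp1))
  have hp0 : (p : ℂ) ≠ 0 := Complex.ofReal_ne_zero.2 hp.ne'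
  have hp2 := one_sub_sq_ne_zero hp hp1
  rw [laurentCoeff_zero hp (differentiableOn_clearedRep hp hp1 hω)
    (fun _ hz hzp => clearedRep_eq_sub_mul hp ω hz hzp) hp1,
    deriv_clearedRep hp hp1 (hω.differentiableAt hpb), discCoord, discRadius]
  push_cast
  rw [← mul_assoc, div_mul_div_cancel₀ hp0, div_self hp2, one_mul]
  ring

theorem discCoord_laurentCoeff_rep_const (c : ℂ) :
    discCoord p (laurentCoeff p (rep p fun _ => c) 0) = discRadius p * c := by
  have h := discCoord_laurentCoeff_rep (ω := fun _ => c) hp hp1 (differentiableOn_const c)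
  rwa [deriv_const, mul_zero, add_zero] at h

theorem norm_discCoord_laurentCoeff_rep_const (c : ℂ) :
    ‖discCoord p (laurentCoeff p (rep p fun _ => c) 0)‖ = discRadius p * ‖c‖ := by
  rw [discCoord_laurentCoeff_rep_const hp hp1, norm_mul,
    Complex.norm_of_nonneg (discRadius_pos hp hp1).le]

theorem exists_laurentCoeff_rep_const_eq {w : ℂ} (hw : ‖discCoord p w‖ ≤ discRadius p) :
    ∃ c : ℂ, ‖c‖ ≤ 1 ∧ laurentCoeff p (rep p fun _ => c) 0 = w := by
  have hR := discRadius_pos hp hp1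
  refine ⟨discCoord p w / discRadius p, ?_, injective_discCoord hp hp1 ?_⟩
  · rw [norm_div, Complex.norm_of_nonneg hR.le]
    exact div_le_one_of_le₀ hw hR.le
  · rw [discCoord_laurentCoeff_rep_const hp hp1, mul_div_cancel₀ _
      (Complex.ofReal_ne_zero.2 hR.ne')]

theorem norm_discCoord_laurentCoeff_rep_le (hp3 : (p + 1) ^ 2 ≤ 3) {ω : ℂ → ℂ}
    (hω : DifferentiableOn ℂ ω (ball 0 1)) (hω1 : ∀ z ∈ ball 0 1, ‖ω z‖ ≤ 1) :
    ‖discCoord p (laurentCoeff p (rep p fun z => ω z) 0)‖ ≤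
      discRadius p - p ^ 3 / (1 - p ^ 4) * (1 - ‖ω p‖) ^ 2 := by
  have hpn := norm_ofReal_lt_one hp hp1
  have hp4 : 0 < 1 - p ^ 4 := sub_pos.2 (pow_lt_one₀ hp.le hp1 four_ne_zero)
  have hωp : 0 ≤ 1 - ‖ω p‖ := sub_nonneg.2 (hω1 p (mem_ball_zero_iff.2 hpn))
  have hpick : p ^ 3 / (1 + p ^ 2) * ‖deriv ω p‖ ≤ p ^ 3 / (1 - p ^ 4) * (1 - ‖ω p‖ ^ 2) := by
    have h := norm_deriv_mul_le_one_sub_norm_sq hω hω1 hpn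
    rw [Complex.norm_of_nonneg hp.le] at h
    rw [div_mul_eq_mul_div, div_mul_eq_mul_div, div_le_div_iff₀ (by positivity) hp4]
    calc p ^ 3 * ‖deriv ω p‖ * (1 - p ^ 4)
        = p ^ 3 * (1 + p ^ 2) * (‖deriv ω p‖ * (1 - p ^ 2)) := by ring
      _ ≤ p ^ 3 * (1 + p ^ 2) * (1 - ‖ω p‖ ^ 2) := by gcongr
      _ = p ^ 3 * (1 - ‖ω p‖ ^ 2) * (1 + p ^ 2) := by ring
  have hslack : 0 ≤ p ^ 2 * ((2 - 2 * p - p ^ 2) * (1 - ‖ω p‖)) / (1 - p ^ 4) :=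
    div_nonneg (mul_nonneg (sq_nonneg p) (mul_nonneg (by linarith) hωp)) hp4.le
  calc ‖discCoord p (laurentCoeff p (rep p fun z => ω z) 0)‖
      ≤ discRadius p * ‖ω p‖ + p ^ 3 / (1 + p ^ 2) * ‖deriv ω p‖ := by
        rw [discCoord_laurentCoeff_rep hp hp1 hω]
        refine (norm_add_le _ _).trans_eq ?_
        rw [norm_mul, norm_mul, Complex.norm_of_nonneg (discRadius_pos hp hp1).le,
          Complex.norm_of_nonneg (by positivity)]
    _ ≤ discRadius p * ‖ω p‖ + p ^ 3 / (1 - p ^ 4) * (1 - ‖ω p‖ ^ 2) := by gcongr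
    _ = discRadius p - p ^ 3 / (1 - p ^ 4) * (1 - ‖ω p‖) ^ 2 -
          p ^ 2 * ((2 - 2 * p - p ^ 2) * (1 - ‖ω p‖)) / (1 - p ^ 4) := by
        rw [discRadius]
        ring
    _ ≤ discRadius p - p ^ 3 / (1 - p ^ 4) * (1 - ‖ω p‖) ^ 2 := sub_le_self _ hslack

theorem IsConcave.norm_discCoord_laurentCoeff_le {f : 𝔻 → OnePoint ℂ} (hf : IsConcave p f)
    (hp3 : (p + 1) ^ 2 ≤ 3) : ‖discCoord p (laurentCoeff p f 0)‖ ≤ discRadius p := by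
  obtain ⟨ω, hω, hω1, rfl⟩ := hf.exists_eq_rep hp hp1
  have hp4 : 0 < 1 - p ^ 4 := sub_pos.2 (pow_lt_one₀ hp.le hp1 four_ne_zero)
  exact (norm_discCoord_laurentCoeff_rep_le hp hp1 hp3 hω hω1).trans
    (sub_le_self _ (by positivity))

theorem IsConcave.exists_eq_rep_const {f : 𝔻 → OnePoint ℂ} (hf : IsConcave p f)
    (hp3 : (p + 1) ^ 2 ≤ 3) (heq : ‖discCoord p (laurentCoeff p f 0)‖ = discRadius p) :
    ∃ c : ℂ, ‖c‖ = 1 ∧ f = rep p fun _ => c := by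
  obtain ⟨ω, hω, hω1, rfl⟩ := hf.exists_eq_rep hp hp1
  have hC : 0 < p ^ 3 / (1 - p ^ 4) :=
    div_pos (pow_pos hp 3) (sub_pos.2 (pow_lt_one₀ hp.le hp1 four_ne_zero))
  have hle : p ^ 3 / (1 - p ^ 4) * (1 - ‖ω p‖) ^ 2 ≤ 0 := by
    linarith [norm_discCoord_laurentCoeff_rep_le hp hp1 hp3 hω hω1]
  have hsq : (1 - ‖ω p‖) ^ 2 = 0 := (nonpos_of_mul_nonpos_right hle hC).antisymm (sq_nonneg _)
  have hωp : ‖ω p‖ = 1 := (sub_eq_zero.1 (pow_eq_zero_iff two_ne_zero |>.1 hsq)).symm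
  refine ⟨ω p, hωp, congrArg (rep p) (funext fun z => ?_)⟩
  exact eq_of_norm_eq_one hω hω1 (norm_ofReal_lt_one hp hp1) z.norm_lt_one hωp

theorem IsConcave.norm_discCoord_laurentCoeff_eq_iff {f : 𝔻 → OnePoint ℂ} (hf : IsConcave p f)
    (hp3 : (p + 1) ^ 2 ≤ 3) : ‖discCoord p (laurentCoeff p f 0)‖ = discRadius p ↔
      ∃ θ ∈ Icc (0 : ℝ) (2 * Real.pi), f = extremal p θ := by
  constructor
  · intro heq
    obtain ⟨c, hc, rfl⟩ := hf.exists_eq_rep_const hp hp1 hp3 heq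
    rw [← mem_sphere_zero_iff_norm, ← image_exp_I_mul_Icc] at hc
    obtain ⟨θ, hθ, rfl⟩ := hc
    exact ⟨θ, hθ, rfl⟩
  · rintro ⟨θ, -, rfl⟩
    rw [extremal, norm_discCoord_laurentCoeff_rep_const hp hp1, Complex.norm_exp_I_mul_ofReal,
      mul_one]

theorem setOf_laurentCoeff_zero_eq (hp3 : (p + 1) ^ 2 ≤ 3) :
    {w | ∃ f ∈ Co p, laurentCoeff p f 0 = w} = {w | ‖discCoord p w‖ ≤ discRadius p} := by
  refine Subset.antisymm ?_ fun w hw => ?_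
  · rintro _ ⟨f, hf, rfl⟩
    exact IsConcave.norm_discCoord_laurentCoeff_le hp hp1 hf hp3
  · obtain ⟨c, hc, hcw⟩ := exists_laurentCoeff_rep_const_eq hp hp1 hw
    exact ⟨_, isConcave_rep_const hp hp1 hc, hcw⟩

end Coefficient

end Concave

end

theorem theorem2 (p : ℝ) (hp : 0 < p) (hp' : p ≤ √3 - 1) :
    -- the Laurent coefficients of every `f ∈ Co(p)` exist and are unique
    (∀ f ∈ Concave.Co p, ∀ a : ℤ → ℂ,
      Concave.HasLaurentExpansion p f a ↔ a = Concave.laurentCoeff p f) ∧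
    -- the exact set of values of `a_0(f)`, `f ∈ Co(p)`
    {w : ℂ | ∃ f ∈ Concave.Co p, Concave.laurentCoeff p f 0 = w} =
      {w : ℂ | ‖((1 - p ^ 2) / p : ℝ) * w + ((1 - p ^ 2 + p ^ 4) / (1 - p ^ 4) : ℝ)‖ ≤
        p ^ 2 * (2 - p ^ 2) / (1 - p ^ 4)} ∧
    -- the case of equality
    (∀ f ∈ Concave.Co p,
      ‖((1 - p ^ 2) / p : ℝ) * Concave.laurentCoeff p f 0 +
          ((1 - p ^ 2 + p ^ 4) / (1 - p ^ 4) : ℝ)‖ = p ^ 2 * (2 - p ^ 2) / (1 - p ^ 4) ↔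
        ∃ θ ∈ Set.Icc (0 : ℝ) (2 * Real.pi), f = Concave.extremal p θ) ∧
    -- the functions with constant `ω` belong to `Co(p)`
    (∀ c : ℂ, ‖c‖ ≤ 1 → Concave.rep p (fun _ => c) ∈ Concave.Co p) ∧
    -- and they attain every point of the disc
    (∀ w : ℂ, ‖((1 - p ^ 2) / p : ℝ) * w + ((1 - p ^ 2 + p ^ 4) / (1 - p ^ 4) : ℝ)‖ ≤
        p ^ 2 * (2 - p ^ 2) / (1 - p ^ 4) →
      ∃ c : ℂ, ‖c‖ ≤ 1 ∧ Concave.laurentCoeff p (Concave.rep p (fun _ => c)) 0 = w) := by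
  have hp3 : (p + 1) ^ 2 ≤ 3 := (Real.le_sqrt' (by positivity)).1 (le_sub_iff_add_le.1 hp')
  have hp1 : p < 1 := by nlinarith
  exact ⟨fun _ hf => Concave.IsConcave.hasLaurentExpansion_iff hp hp1 hf,
    Concave.setOf_laurentCoeff_zero_eq hp hp1 hp3,
    fun _ hf => Concave.IsConcave.norm_discCoord_laurentCoeff_eq_iff hp hp1 hf hp3,
    fun _ => Concave.isConcave_rep_const hp hp1,
    fun _ => Concave.exists_laurentCoeff_rep_const_eq hp hp1⟩
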